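/- Let $0<q<\infty$, $1\le p_1,p_2\le\infty$ and $p_1\le q$. For $t>0$ write $B(0,t)=\{x\in\mathbb{R}^n:|x|<t\}$ and ${}^cB(0,t)=\mathbb{R}^n\setminus B(0,t)$. A weight on an open set $\Omega$ is a non-negative function that is locally integrable on $\Omega$ with respect to Lebesgue measure. For a weight (or non-negative measurable function) $w$ and a non-negative measurable $f$ on $\Omega$ put $\|f\|_{p,w,\Omega}=\big(\int_\Omega f^p w\big)^{1/p}$ if $0<p<\infty$ and $\|f\|_{\infty,w,\Omega}=\operatorname{ess\,sup}_\Omega fw$; put $\|f\|_{p,\Omega}=\|f\|_{p,1,\Omega}$. For $p\in[1,\infty]$ let $1/p+1/p'=1$. The conventions $0\cdot\infty=0$ and $0^{-s}=\infty$ for $s>0$ are used. There are constants $c_1,c_2\in(0,\infty)$, depending only on $p_1,p_2,q$, such that the following holds for every $n\ge1$, every weight $u$ on $(0,\infty)$ and all weights $v_1,v_2$ on $\mathbb{R}^n$. Put $U(t)=\int_0^t u(s)\,ds\in[0,\infty]$, and consider the inequality $$\Big\|\int_{{}^cB(0,\cdot)}f\cdot\int_{{}^cB(0,\cdot)}g\Big\|_{q,u,(0,\infty)}\le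 C\,\|f\|_{p_1,v_1,\mathbb{R}^n}\,\|g\|_{p_2,v_2,\mathbb{R}^n}\qquad\text{for all non-negative measurable } f,g \text{ on }\mathbb{R}^n. \tag{1}$$ Let $C_*\in[0,\infty]$ be the best constant, that is, the infimum of all $C\in[0,\infty)$ for which (1) holds ($C_*=\infty$ if there is none). (a) If $p_2\le q$, then (1) holds for some $C<\infty$ if and only if $$B_1:=\sup_{t>0}U(t)^{1/q}\,\big\|v_1^{-1/p_1}\big\|_{p_1',{}^cB(0,t)}\,\big\|v_2^{-1/p_2}\big\|_{p_2',{}^cB(0,t)}<\infty ,$$ and $c_1B_1\le C_*\le c_2B_1$. (b) If $q<p_2<\infty$ and $1/r_2=1/q-1/p_2$, then (1) holds for some $C<\infty$ if and only if $$B_2:=\sup_{t>0}\big\|v_1^{-1/p_1}\big\|_{p_1',{}^cB(0,t)}\Big(\int_0^tU(y)^{r_2/p_2}\,u(y)\,\big\|v_2^{-1/p_2}\big\|_{p_2',{}^cB(0,y)}^{r_2}\,dy\Big)^{1/r_2}<\infty ,$$ and $c_1B_2\le C_*\le c_2B_2$. (c) If $p_2=\infty$, then (1) holds for some $C<\infty$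 if and only if $$B_3:=\sup_{t>0}\big\|v_1^{-1/p_1}\big\|_{p_1',{}^cB(0,t)}\Big(\int_0^tu(y)\,\big\|v_2^{-1}\big\|_{1,{}^cB(0,y)}^{q}\,dy\Big)^{1/q}<\infty ,$$ and $c_1B_3\le C_*\le c_2B_3$. -/

import Mathlib

open MeasureTheory Set
open scoped ENNReal NNReal

noncomputable section

namespace BilinearHardy

/-- `w` is a weight on `Ω`: a non-negative function, locally integrable on `Ω` with respect to
Lebesgue measure. -/
def IsWeightOn {X : Type*} [TopologicalSpace X] [MeasureSpace X] (w : X → ℝ≥0) (Ω : Set X) :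
    Prop :=
  LocallyIntegrableOn (fun x => (w x : ℝ)) Ω volume

/-- The functional `‖f‖_{p,w,Ω}`, `0 < p ≤ ∞`, for non-negative `f`: it is
`(∫_Ω f ^ p w) ^ (1 / p)` if `p < ∞` and `ess sup_Ω f w` if `p = ∞`. -/
def wNorm {X : Type*} [MeasureSpace X] (p : ℝ≥0∞) (w : X → ℝ≥0∞) (Ω : Set X) (f : X → ℝ≥0∞) :
    ℝ≥0∞ :=
  if p = ∞ then essSup (fun x => f x * w x) (volume.restrict Ω)
  else (∫⁻ x in Ω, f x ^ p.toReal * w x) ^ (1 / p.toReal)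

/-- The unweighted functional `‖f‖_{p,Ω}`. -/
def lpNorm {X : Type*} [MeasureSpace X] (p : ℝ≥0∞) (Ω : Set X) (f : X → ℝ≥0∞) : ℝ≥0∞ :=
  wNorm p (fun _ => 1) Ω f

/-- The complement of the open Euclidean ball `B(0,t)` in `ℝⁿ`. -/
def coBall (n : ℕ) (t : ℝ) : Set (EuclideanSpace ℝ (Fin n)) :=
  (Metric.ball 0 t)ᶜ

/-- `U(t) = ∫_0^t u`. -/
def primitive (u : ℝ → ℝ≥0) (t : ℝ) : ℝ≥0∞ :=
  ∫⁻ s in Ioo 0 t, (u s : ℝ≥0∞)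

/-- For `1 ≤ p < ∞`, the dual norm `‖v ^ (-1/p)‖_{p', ℝⁿ ∖ B(0,t)}` with `1/p + 1/p' = 1`;
here `0 ^ (-1/p) = ∞`. -/
def dualNorm {n : ℕ} (p : ℝ≥0∞) (v : EuclideanSpace ℝ (Fin n) → ℝ≥0) (t : ℝ) : ℝ≥0∞ :=
  lpNorm p.conjExponent (coBall n t) (fun x => (v x : ℝ≥0∞) ^ (-1 / p.toReal))

/-- The case `p = ∞`: `‖v⁻¹‖_{1, ℝⁿ ∖ B(0,t)}`, where `0⁻¹ = ∞`. -/
def dualNormTop {n : ℕ} (v : EuclideanSpace ℝ (Fin n) → ℝ≥0) (t : ℝ) : ℝ≥0∞ :=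
  lpNorm 1 (coBall n t) (fun x => (v x : ℝ≥0∞)⁻¹)

/-- The bilinear Hardy inequality with constant `C`:
`‖∫_{ℝⁿ ∖ B(0,·)} f · ∫_{ℝⁿ ∖ B(0,·)} g‖_{q,u,(0,∞)} ≤ C ‖f‖_{p₁,v₁,ℝⁿ} ‖g‖_{p₂,v₂,ℝⁿ}`
for all non-negative (Lebesgue) measurable `f`, `g` on `ℝⁿ`. -/
def HardyIneq {n : ℕ} (p₁ p₂ q : ℝ≥0∞) (u : ℝ → ℝ≥0)
    (v₁ v₂ : EuclideanSpace ℝ (Fin n) → ℝ≥0) (C : ℝ≥0) : Prop :=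
  ∀ f g : EuclideanSpace ℝ (Fin n) → ℝ≥0∞, AEMeasurable f → AEMeasurable g →
    wNorm q (fun t => (u t : ℝ≥0∞)) (Ioi (0 : ℝ))
        (fun t => (∫⁻ x in coBall n t, f x) * ∫⁻ x in coBall n t, g x)
      ≤ C * wNorm p₁ (fun x => (v₁ x : ℝ≥0∞)) univ f * wNorm p₂ (fun x => (v₂ x : ℝ≥0∞)) univ g

/-- The best constant in the bilinear Hardy inequality (`∞` if there is no finite constant). -/
def bestConst {n : ℕ} (p₁ p₂ q : ℝ≥0∞) (u : ℝ → ℝ≥0)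
    (v₁ v₂ : EuclideanSpace ℝ (Fin n) → ℝ≥0) : ℝ≥0∞ :=
  ⨅ (C : ℝ≥0) (_ : HardyIneq p₁ p₂ q u v₁ v₂ C), (C : ℝ≥0∞)

/-- `B₁ = sup_{t>0} U(t)^{1/q} ‖v₁^{-1/p₁}‖_{p₁',ℝⁿ∖B(0,t)} ‖v₂^{-1/p₂}‖_{p₂',ℝⁿ∖B(0,t)}`. -/
def B₁ {n : ℕ} (p₁ p₂ q : ℝ≥0∞) (u : ℝ → ℝ≥0)
    (v₁ v₂ : EuclideanSpace ℝ (Fin n) → ℝ≥0) : ℝ≥0∞ :=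
  ⨆ t ∈ Ioi (0 : ℝ), primitive u t ^ (1 / q.toReal) * dualNorm p₁ v₁ t * dualNorm p₂ v₂ t

/-- `B₂ = sup_{t>0} ‖v₁^{-1/p₁}‖_{p₁',ℝⁿ∖B(0,t)}
(∫_0^t U(y)^{r₂/p₂} u(y) ‖v₂^{-1/p₂}‖_{p₂',ℝⁿ∖B(0,y)}^{r₂} dy)^{1/r₂}`. -/
def B₂ {n : ℕ} (p₁ p₂ : ℝ≥0∞) (r₂ : ℝ) (u : ℝ → ℝ≥0)
    (v₁ v₂ : EuclideanSpace ℝ (Fin n) → ℝ≥0) : ℝ≥0∞ :=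
  ⨆ t ∈ Ioi (0 : ℝ), dualNorm p₁ v₁ t *
    (∫⁻ y in Ioo 0 t, primitive u y ^ (r₂ / p₂.toReal) * u y * dualNorm p₂ v₂ y ^ r₂) ^ (1 / r₂)

/-- `B₃ = sup_{t>0} ‖v₁^{-1/p₁}‖_{p₁',ℝⁿ∖B(0,t)}
(∫_0^t u(y) ‖v₂⁻¹‖_{1,ℝⁿ∖B(0,y)}^q dy)^{1/q}`. -/
def B₃ {n : ℕ} (p₁ q : ℝ≥0∞) (u : ℝ → ℝ≥0)
    (v₁ v₂ : EuclideanSpace ℝ (Fin n) → ℝ≥0) : ℝ≥0∞ :=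
  ⨆ t ∈ Ioi (0 : ℝ), dualNorm p₁ v₁ t *
    (∫⁻ y in Ioo 0 t, u y * dualNormTop v₂ y ^ q.toReal) ^ (1 / q.toReal)

end BilinearHardy

end

/-!
Write `F(t) = ∫_{ℝⁿ ∖ B(0,t)} f`, `G(t) = ∫_{ℝⁿ ∖ B(0,t)} g` and let `D₁`, `D₂` be the dual norms of
the weights. For fixed `g` the bilinear inequality is the linear Hardy inequality for `f` with the
weight `u G ^ q` on `(0,∞)`. Since `p₁ ≤ q`, it holds if and only if
`D₁(t) (∫_0^t u G ^ q) ^ (1/q) ≤ C ‖g‖` for all `t`, and this is, for each `t`, the linear Hardy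
inequality for `g` with the weight `u` on `(0,t)`. The characterizations of the latter for `p₂ ≤ q`,
`q < p₂ < ∞` and `p₂ = ∞` give `B₁`, `B₂` and `B₃`. The two steps are
`HardyIneq.dualNorm_mul_le` (necessity) and `hardyIneq_of_lintegral_le` (sufficiency).

The linear Hardy inequalities (`HolderBound.lintegral_rpow_tail_le` and
`HolderBound.lintegral_rpow_tail_le_of_lt`) are proved by cutting `(0,∞)` into the sets where `F` lies
in `(2 ^ k, 2 ^ (k + 1)]`. If `s` is such a point, then the part of `f` beyond `s` on which
`2 ^ (k - 1) < F(|x|) ≤ 2 ^ (k + 1)` has integral at least `2 ^ (k - 1)`, and Hölder's inequality bounds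
this integral by `D(s)` times the norm of that part of `f`. The parts overlap at most twice, so that the
resulting series are summed by `ℓ ^ p ⊆ ℓ ^ q` if `p ≤ q` and by Hölder's inequality if `q < p`.

No differentiation or integration by parts is needed: powers of a primitive are compared with
integrals by the remark that `{s | μ (Iic s) ≤ c}` has `μ`-measure at most `c`
(`measure_setOf_measure_Iic_le`), which leaves at least half of the mass of `μ` where
`μ (Iic s) ≥ μ univ / 2` (`rpow_measure_univ_le_lintegral`).

The lower bounds of the constant come from test functions. The dual norm is attained up to truncation
(`exists_lintegral_coBall_ge`); for `q < p₂ < ∞` the test function is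
`U(|x|) ^ (r / (p₂ q)) S(|x|) ^ (r (q - 1) / (p₂ q)) h(x)`, where `h` is a truncation of
`v₂ ^ (1 - p₂')` and `S(t) = ∫_{ℝⁿ ∖ B(0,t)} h` (`HardyIneq.dualNorm_mul_lintegral_tail_le`).
The truncation makes all quantities finite and is removed by monotone convergence.
-/

namespace BilinearHardy

/-! ### Mass of the sublevel sets of a distribution function -/

section

/-- The sublevel set is a half-line, exhausted by the sets `Iic s` with `s` in it. -/
theorem measure_setOf_measure_Iic_le (μ : Measure ℝ) (c : ℝ≥0∞) :
    μ {s | μ (Iic s) ≤ c} ≤ c := by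
  set S : Set ℝ := {s | μ (Iic s) ≤ c}
  have hlow : ∀ s ∈ S, ∀ t ≤ s, t ∈ S := fun s hs t hts =>
    (measure_mono (Iic_subset_Iic.2 hts)).trans hs
  by_cases hmax : ∃ τ ∈ S, ∀ s ∈ S, s ≤ τ
  · obtain ⟨τ, hτ, hle⟩ := hmax
    exact (measure_mono fun s hs => hle s hs).trans hτ
  · push Not at hmax
    have hU : S ⊆ ⋃ x ∈ {x : ℚ | (x : ℝ) ∈ S}, Iic (x : ℝ) := by
      intro s hs
      obtain ⟨s', hs', hlt⟩ := hmax s hs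
      obtain ⟨x, hx1, hx2⟩ := exists_rat_btwn hlt
      exact mem_biUnion (show x ∈ {x : ℚ | (x : ℝ) ∈ S} from hlow s' hs' x hx2.le) hx1.le
    refine (measure_mono hU).trans ?_
    rw [measure_biUnion_eq_iSup (to_countable _)]
    · exact iSup₂_le fun x hx => hx
    · intro x hx y hy
      refine ⟨max x y, ?_, ?_, ?_⟩
      · rcases max_choice x y with h | h <;> rw [h] <;> assumption
      · exact Iic_subset_Iic.2 (by exact_mod_cast le_max_left x y)
      · exact Iic_subset_Iic.2 (by exact_mod_cast le_max_right x y)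

theorem measure_univ_le_of_ae_measure_Iic_le {μ : Measure ℝ} {c : ℝ≥0∞}
    (h : ∀ᵐ s ∂μ, μ (Iic s) ≤ c) : μ univ ≤ c := by
  have : μ univ = μ {s | μ (Iic s) ≤ c} := by
    rw [measure_congr (Filter.eventuallyEq_univ.2 h)]
  rw [this]
  exact measure_setOf_measure_Iic_le μ c

theorem ae_measure_Iic_ne_zero (μ : Measure ℝ) : ∀ᵐ s ∂μ, μ (Iic s) ≠ 0 := by
  have := measure_setOf_measure_Iic_le μ 0
  simpa [ae_iff] using this

variable {X : Type*} [MeasurableSpace X]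

theorem map_neg_Iic (ν : Measure X) {ρ : X → ℝ} (hρ : Measurable ρ) (t : ℝ) :
    ν.map (fun x => -ρ x) (Iic (-t)) = ν {y | t ≤ ρ y} := by
  have hn : Measurable fun x => -ρ x := hρ.neg
  rw [Measure.map_apply hn measurableSet_Iic]
  congr 1
  ext y
  simp

theorem measure_setOf_measure_superlevel_le (ν : Measure X) {ρ : X → ℝ} (hρ : Measurable ρ)
    (c : ℝ≥0∞) : ν {x | ν {y | ρ x ≤ ρ y} ≤ c} ≤ c := by
  have h := measure_setOf_measure_Iic_le (ν.map fun x => -ρ x) c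
  have hn : Measurable fun x => -ρ x := hρ.neg
  refine le_trans ?_ ((Measure.le_map_apply hn.aemeasurable _).trans h)
  refine measure_mono fun x hx => ?_
  simpa only [mem_preimage, mem_ofPred_eq, map_neg_Iic ν hρ] using hx

theorem measurable_measure_Iic (μ : Measure ℝ) : Measurable fun s => μ (Iic s) :=
  Monotone.measurable fun _ _ h => measure_mono (Iic_subset_Iic.2 h)

theorem antitone_measure_superlevel (ν : Measure X) (ρ : X → ℝ) :
    Antitone fun t : ℝ => ν {y | t ≤ ρ y} :=
  fun _ _ h => measure_mono fun _ hy => le_trans h hy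

/-- At least half of the mass of `μ` lies where `μ (Iic s) ≥ μ univ / 2`. -/
theorem rpow_measure_univ_le_lintegral (μ : Measure ℝ) {a : ℝ} (ha : 0 ≤ a) :
    μ univ ^ (a + 1) ≤ 2 ^ (a + 1) * ∫⁻ s, μ (Iic s) ^ a ∂μ := by
  have key : ∀ c : ℝ≥0∞, c ^ a * (μ univ - c) ≤ ∫⁻ s, μ (Iic s) ^ a ∂μ := by
    intro c
    have hmeas : MeasurableSet {s | μ (Iic s) ≤ c} :=
      measurable_measure_Iic μ measurableSet_Iic
    calc c ^ a * (μ univ - c) ≤ c ^ a * μ {s | μ (Iic s) ≤ c}ᶜ := by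
          gcongr
          rw [tsub_le_iff_left, ← measure_add_measure_compl hmeas]
          gcongr
          exact measure_setOf_measure_Iic_le μ c
      _ = ∫⁻ _ in {s | μ (Iic s) ≤ c}ᶜ, c ^ a ∂μ := by rw [setLIntegral_const]
      _ ≤ ∫⁻ s in {s | μ (Iic s) ≤ c}ᶜ, μ (Iic s) ^ a ∂μ := by
          refine setLIntegral_mono' hmeas.compl fun s hs => ?_
          exact ENNReal.rpow_le_rpow (not_le.1 (by simpa using hs)).le ha
      _ ≤ _ := setLIntegral_le_lintegral _ _
  rcases eq_or_ne (μ univ) ∞ with h | h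
  · have := key 1
    rw [h] at this
    simp only [ENNReal.one_rpow, one_mul, ENNReal.top_sub ENNReal.one_ne_top, top_le_iff] at this
    rw [this, ENNReal.mul_top (by positivity)]
    exact le_top
  · have := key (μ univ / 2)
    rw [ENNReal.sub_half h] at this
    calc μ univ ^ (a + 1) = (2 * (μ univ / 2)) ^ (a + 1) := by
          rw [ENNReal.mul_div_cancel (by norm_num) (by norm_num)]
      _ = 2 ^ (a + 1) * ((μ univ / 2) ^ a * (μ univ / 2)) := by
          rw [ENNReal.mul_rpow_of_nonneg _ _ (by linarith),
            ENNReal.rpow_add_of_nonneg (x := μ univ / 2) _ _ ha zero_le_one, ENNReal.rpow_one]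
      _ ≤ _ := by gcongr

theorem rpow_measure_univ_le_lintegral_superlevel (ν : Measure X) {ρ : X → ℝ}
    (hρ : Measurable ρ) {a : ℝ} (ha : 0 ≤ a) :
    ν univ ^ (a + 1) ≤ 2 ^ (a + 1) * ∫⁻ x, ν {y | ρ x ≤ ρ y} ^ a ∂ν := by
  have h := rpow_measure_univ_le_lintegral (ν.map fun x => -ρ x) ha
  have hn : Measurable fun x => -ρ x := hρ.neg
  rw [lintegral_map ((measurable_measure_Iic _).pow_const a) hn,
    Measure.map_apply hn MeasurableSet.univ, preimage_univ] at h
  simpa only [map_neg_Iic ν hρ] using h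

end

/-! ### Hardy inequalities for tails of measures -/

section

variable {X : Type*} [MeasurableSpace X]

/-- The tail `s ↦ ν {x | s ≤ ρ x}` of a measure `ν` along `ρ`; for `ρ = ‖·‖` and `ν = f dx` it is
`∫_{ℝⁿ ∖ B(0,s)} f`. -/
def tail (ν : Measure X) (ρ : X → ℝ) (s : ℝ) : ℝ≥0∞ := ν {x | s ≤ ρ x}

theorem antitone_tail (ν : Measure X) (ρ : X → ℝ) : Antitone (tail ν ρ) :=
  antitone_measure_superlevel ν ρ

theorem measurable_tail (ν : Measure X) (ρ : X → ℝ) : Measurable (tail ν ρ) :=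
  (antitone_tail ν ρ).measurable

/-- The points where the tail of `ν` lies in the dyadic interval `(2 ^ k, 2 ^ (k + 1)]`. -/
def dyadicLayer (ν : Measure X) (ρ : X → ℝ) (k : ℤ) : Set ℝ :=
  tail ν ρ ⁻¹' Ioc (2 ^ k) (2 ^ (k + 1))

theorem measurableSet_dyadicLayer (ν : Measure X) (ρ : X → ℝ) (k : ℤ) :
    MeasurableSet (dyadicLayer ν ρ k) :=
  measurable_tail ν ρ measurableSet_Ioc

theorem two_zpow_add_one (k : ℤ) : (2 : ℝ≥0∞) ^ (k + 1) = 2 * 2 ^ k := by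
  rw [ENNReal.zpow_add (by norm_num) (by norm_num), zpow_one, mul_comm]

theorem two_zpow_ne_zero (k : ℤ) : (2 : ℝ≥0∞) ^ k ≠ 0 :=
  (ENNReal.zpow_pos (by norm_num) (by norm_num) k).ne'

theorem two_zpow_ne_top (k : ℤ) : (2 : ℝ≥0∞) ^ k ≠ ∞ :=
  (ENNReal.zpow_lt_top (by norm_num) (by norm_num) k).ne

theorem pairwise_disjoint_dyadicLayer (ν : Measure X) (ρ : X → ℝ) :
    Pairwise (Function.onFun Disjoint (dyadicLayer ν ρ)) := by
  have hmono : Monotone fun k : ℤ => (2 : ℝ≥0∞) ^ k := fun a b h =>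
    ENNReal.zpow_le_of_le (by norm_num) h
  intro i j hij
  exact (hmono.pairwise_disjoint_on_Ioc_succ hij).preimage _

theorem lintegral_rpow_tail_le_tsum {μ : Measure ℝ} {ν : Measure X} {ρ : X → ℝ} {q : ℝ}
    (hq : 0 < q) (hfin : ∀ᵐ s ∂μ, tail ν ρ s ≠ ∞) :
    ∫⁻ s, tail ν ρ s ^ q ∂μ ≤ ∑' k : ℤ, ((2 : ℝ≥0∞) ^ (k + 1)) ^ q * μ (dyadicLayer ν ρ k) := by
  calc ∫⁻ s, tail ν ρ s ^ q ∂μ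
      ≤ ∫⁻ s, ∑' k : ℤ, (dyadicLayer ν ρ k).indicator (fun _ => ((2 : ℝ≥0∞) ^ (k + 1)) ^ q) s
          ∂μ := by
        refine lintegral_mono_ae (hfin.mono fun s hs => ?_)
        rcases eq_or_ne (tail ν ρ s) 0 with h0 | h0
        · simp [h0, hq]
        obtain ⟨k, hk⟩ := ENNReal.exists_mem_Ioc_zpow h0 hs (y := 2) (by norm_num) (by norm_num)
        refine le_trans ?_ (ENNReal.le_tsum k)
        rw [indicator_of_mem (show s ∈ dyadicLayer ν ρ k from hk)]
        exact ENNReal.rpow_le_rpow hk.2 hq.le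
    _ = _ := by
        rw [lintegral_tsum fun k =>
          (measurable_const.indicator (measurableSet_dyadicLayer ν ρ k)).aemeasurable]
        simp_rw [lintegral_indicator (measurableSet_dyadicLayer ν ρ _), setLIntegral_const]

/-- Two adjacent dyadic layers, as a subset of `X`. Mass at least `2 ^ (k - 1)` of `ν` lies in this
set and beyond any given point of the layer `k`, see `two_zpow_le_measure_inter_doubleLayer`;
no continuity of the tail is needed for that. -/
def doubleLayer (ν : Measure X) (ρ : X → ℝ) (k : ℤ) : Set X :=
  ρ ⁻¹' (dyadicLayer ν ρ (k - 1) ∪ dyadicLayer ν ρ k)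

theorem two_zpow_le_measure_inter_doubleLayer (ν : Measure X) {ρ : X → ℝ} (hρ : Measurable ρ)
    {k : ℤ} {s : ℝ} (hs : s ∈ dyadicLayer ν ρ k) :
    (2 : ℝ≥0∞) ^ (k - 1) ≤ ν ({x | s ≤ ρ x} ∩ doubleLayer ν ρ k) := by
  have hsub : {x | s ≤ ρ x} ⊆ {x | ν {y | ρ x ≤ ρ y} ≤ 2 ^ (k - 1)} ∪
      ({x | s ≤ ρ x} ∩ doubleLayer ν ρ k) := by
    intro x hx
    by_cases h : ν {y | ρ x ≤ ρ y} ≤ 2 ^ (k - 1)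
    · exact Or.inl h
    · refine Or.inr ⟨hx, ?_⟩
      have h1 : tail ν ρ (ρ x) ≤ 2 ^ (k + 1) := (antitone_tail ν ρ hx).trans hs.2
      by_cases h2 : tail ν ρ (ρ x) ≤ 2 ^ k
      · exact Or.inl ⟨not_le.1 h, by simpa using h2⟩
      · exact Or.inr ⟨not_le.1 h2, h1⟩
  have h : (2 : ℝ≥0∞) ^ (k - 1) + 2 ^ (k - 1) ≤
      2 ^ (k - 1) + ν ({x | s ≤ ρ x} ∩ doubleLayer ν ρ k) := by
    calc (2 : ℝ≥0∞) ^ (k - 1) + 2 ^ (k - 1) = 2 ^ k := by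
          rw [← two_mul, ← two_zpow_add_one, sub_add_cancel]
      _ ≤ tail ν ρ s := hs.1.le
      _ ≤ _ := (measure_mono hsub).trans (measure_union_le _ _)
      _ ≤ _ := by gcongr; exact measure_setOf_measure_superlevel_le ν hρ _
  exact (ENNReal.add_le_add_iff_left (two_zpow_ne_top _)).1 h

theorem measurableSet_doubleLayer (ν : Measure X) {ρ : X → ℝ} (hρ : Measurable ρ) (k : ℤ) :
    MeasurableSet (doubleLayer ν ρ k) :=
  hρ ((measurableSet_dyadicLayer ν ρ _).union (measurableSet_dyadicLayer ν ρ _))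

theorem tsum_measure_doubleLayer_le (ν κ : Measure X) {ρ : X → ℝ} (hρ : Measurable ρ) :
    ∑' k, κ (doubleLayer ν ρ k) ≤ 2 * κ univ := by
  have h1 : ∑' k, κ (ρ ⁻¹' dyadicLayer ν ρ k) ≤ κ univ := by
    rw [← measure_iUnion (fun i j hij => (pairwise_disjoint_dyadicLayer ν ρ hij).preimage ρ)
      (fun k => hρ (measurableSet_dyadicLayer ν ρ k))]
    exact measure_mono (subset_univ _)
  calc ∑' k, κ (doubleLayer ν ρ k)
      ≤ ∑' k, (κ (ρ ⁻¹' dyadicLayer ν ρ (k - 1)) + κ (ρ ⁻¹' dyadicLayer ν ρ k)) :=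
        ENNReal.tsum_le_tsum fun k => measure_union_le _ _
    _ = ∑' k, κ (ρ ⁻¹' dyadicLayer ν ρ k) + ∑' k, κ (ρ ⁻¹' dyadicLayer ν ρ k) := by
        have h2 := (Equiv.subRight (1 : ℤ)).tsum_eq fun k => κ (ρ ⁻¹' dyadicLayer ν ρ k)
        simp only [Equiv.subRight_apply] at h2
        rw [ENNReal.tsum_add, h2]
    _ ≤ _ := by rw [two_mul]; gcongr

/-- `D` bounds `ν` by `κ` along `ρ`: the form in which Hölder's inequality
`∫_A f ≤ ‖v ^ (-1/p)‖_{p', {t ≤ ρ}} (∫_A f ^ p v) ^ (1/p)`, `A ⊆ {t ≤ ρ}`, is used,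
with `ν = f dx` and `κ = f ^ p v dx`. -/
def HolderBound (p : ℝ) (D : ℝ → ℝ≥0∞) (ν κ : Measure X) (ρ : X → ℝ) : Prop :=
  ∀ t, D t ≠ ∞ → ∀ A, MeasurableSet A → A ⊆ {x | t ≤ ρ x} → ν A ≤ D t * κ A ^ (1 / p)

theorem HolderBound.tail_le {p : ℝ} {D : ℝ → ℝ≥0∞} {ν κ : Measure X} {ρ : X → ℝ}
    (hD : HolderBound p D ν κ ρ) (hp : 0 < p) (hρ : Measurable ρ) {t : ℝ} (ht : D t ≠ ∞) :
    tail ν ρ t ≤ D t * κ univ ^ (1 / p) :=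
  (hD t ht _ (hρ measurableSet_Ici) subset_rfl).trans (by gcongr; exact subset_univ _)

theorem HolderBound.ae_tail_ne_top {p : ℝ} {D : ℝ → ℝ≥0∞} {ν κ : Measure X} {ρ : X → ℝ}
    (hD : HolderBound p D ν κ ρ) (hp : 0 < p) (hρ : Measurable ρ) (hκ : κ univ ≠ ∞)
    {μ : Measure ℝ} (hμ : ∀ᵐ s ∂μ, D s ≠ ∞) : ∀ᵐ s ∂μ, tail ν ρ s ≠ ∞ :=
  hμ.mono fun _ hs => ne_top_of_le_ne_top
    (ENNReal.mul_ne_top hs (ENNReal.rpow_ne_top_of_nonneg (by positivity) hκ)) (hD.tail_le hp hρ hs)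

theorem HolderBound.two_zpow_le {p : ℝ} {D : ℝ → ℝ≥0∞} {ν κ : Measure X} {ρ : X → ℝ}
    (hD : HolderBound p D ν κ ρ) (hp : 0 < p) (hρ : Measurable ρ) {k : ℤ} {s : ℝ}
    (hs : s ∈ dyadicLayer ν ρ k) (ht : D s ≠ ∞) :
    (2 : ℝ≥0∞) ^ (k - 1) ≤ D s * κ (doubleLayer ν ρ k) ^ (1 / p) :=
  (two_zpow_le_measure_inter_doubleLayer ν hρ hs).trans <|
    (hD s ht _ ((hρ measurableSet_Ici).inter (measurableSet_doubleLayer ν hρ k))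
      inter_subset_left).trans (by gcongr; exact inter_subset_right)

theorem rpow_eq_mul_rpow_sub_one (y : ℝ≥0∞) {a : ℝ} (ha : 1 ≤ a) : y ^ a = y * y ^ (a - 1) := by
  conv_lhs => rw [← add_sub_cancel 1 a]
  rw [ENNReal.rpow_add_of_nonneg _ _ zero_le_one (by linarith), ENNReal.rpow_one]

theorem tsum_rpow_le_rpow_tsum {ι : Type*} (x : ι → ℝ≥0∞) {a : ℝ} (ha : 1 ≤ a) :
    ∑' i, x i ^ a ≤ (∑' i, x i) ^ a := by
  rw [rpow_eq_mul_rpow_sub_one _ ha, ← ENNReal.tsum_mul_right]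
  refine ENNReal.tsum_le_tsum fun i => ?_
  rw [rpow_eq_mul_rpow_sub_one _ ha]
  exact mul_le_mul' le_rfl (ENNReal.rpow_le_rpow (ENNReal.le_tsum i) (by linarith))

theorem tsum_rpow_mul_rpow_le (x y : ℤ → ℝ≥0∞) {a b : ℝ} (ha : 0 ≤ a) (hb : 0 ≤ b)
    (hab : a + b = 1) : ∑' i, x i ^ a * y i ^ b ≤ (∑' i, x i) ^ a * (∑' i, y i) ^ b := by
  have := ENNReal.lintegral_mul_norm_pow_le (μ := Measure.count) (f := x) (g := y)
    (measurable_of_countable _).aemeasurable (measurable_of_countable _).aemeasurable ha hb hab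
  simpa [lintegral_count] using this

theorem four_rpow_mul_two_zpow (k : ℤ) {q : ℝ} (hq : 0 < q) :
    ((2 : ℝ≥0∞) ^ (k + 1)) ^ q = 4 ^ q * (2 ^ (k - 1)) ^ q := by
  rw [← ENNReal.mul_rpow_of_nonneg _ _ hq.le]
  congr 1
  rw [two_zpow_add_one]
  conv_lhs => rw [← sub_add_cancel k 1, two_zpow_add_one, ← mul_assoc]
  norm_num

/-- The weighted Hardy inequality for `p ≤ q`. On each dyadic layer of the tail,
`two_zpow_le` bounds the tail at the point `s` by `D s`, and letting `s` run through the layer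
turns `μ (Iic s) D(s)^q ≤ B^q` into a bound of the mass of the whole layer. -/
theorem HolderBound.lintegral_rpow_tail_le {p q : ℝ} {D : ℝ → ℝ≥0∞} {ν κ : Measure X} {ρ : X → ℝ}
    (hD : HolderBound p D ν κ ρ) (hp : 0 < p) (hpq : p ≤ q) (hρ : Measurable ρ)
    (hκ : κ univ ≠ ∞) {μ : Measure ℝ} (hμ : ∀ᵐ s ∂μ, D s ≠ ∞) {B : ℝ≥0∞}
    (hB : ∀ᵐ s ∂μ, μ (Iic s) * D s ^ q ≤ B ^ q) :
    ∫⁻ s, tail ν ρ s ^ q ∂μ ≤ (4 * B) ^ q * (2 * κ univ) ^ (q / p) := by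
  have hq : 0 < q := hp.trans_le hpq
  refine (lintegral_rpow_tail_le_tsum hq (hD.ae_tail_ne_top hp hρ hκ hμ)).trans ?_
  have hk : ∀ k : ℤ, ((2 : ℝ≥0∞) ^ (k + 1)) ^ q * μ (dyadicLayer ν ρ k) ≤
      (4 * B) ^ q * κ (doubleLayer ν ρ k) ^ (q / p) := by
    intro k
    set c : ℝ≥0∞ := (2 ^ (k - 1)) ^ q
    have hc0 : c ≠ 0 := (ENNReal.rpow_pos (pos_iff_ne_zero.2 (two_zpow_ne_zero _))
      (two_zpow_ne_top _)).ne'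
    have hct : c ≠ ∞ := ENNReal.rpow_ne_top_of_nonneg hq.le (two_zpow_ne_top _)
    have hE := measurableSet_dyadicLayer ν ρ k
    have h1 : μ.restrict (dyadicLayer ν ρ k) univ ≤
        B ^ q * κ (doubleLayer ν ρ k) ^ (q / p) / c := by
      refine measure_univ_le_of_ae_measure_Iic_le ?_
      filter_upwards [ae_restrict_of_ae hμ, ae_restrict_of_ae hB, ae_restrict_mem hE]
        with s hs1 hs2 hs3
      rw [ENNReal.le_div_iff_mul_le (Or.inl hc0) (Or.inl hct)]
      calc μ.restrict (dyadicLayer ν ρ k) (Iic s) * c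
          ≤ μ (Iic s) * (D s * κ (doubleLayer ν ρ k) ^ (1 / p)) ^ q := by
            gcongr
            · exact Measure.restrict_le_self
            · exact ENNReal.rpow_le_rpow (hD.two_zpow_le hp hρ hs3 hs1) hq.le
        _ = μ (Iic s) * D s ^ q * κ (doubleLayer ν ρ k) ^ (q / p) := by
            rw [ENNReal.mul_rpow_of_nonneg _ _ hq.le, ← ENNReal.rpow_mul, one_div_mul_eq_div,
              mul_assoc]
        _ ≤ _ := by gcongr
    rw [Measure.restrict_apply_univ, ENNReal.le_div_iff_mul_le (Or.inl hc0) (Or.inl hct)] at h1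
    rw [four_rpow_mul_two_zpow k hq, ENNReal.mul_rpow_of_nonneg _ _ hq.le]
    calc 4 ^ q * c * μ (dyadicLayer ν ρ k) = 4 ^ q * (μ (dyadicLayer ν ρ k) * c) := by ring
      _ ≤ 4 ^ q * (B ^ q * κ (doubleLayer ν ρ k) ^ (q / p)) := by gcongr
      _ = _ := by ring
  calc _ ≤ ∑' k, (4 * B) ^ q * κ (doubleLayer ν ρ k) ^ (q / p) := ENNReal.tsum_le_tsum hk
    _ ≤ _ := by
      rw [ENNReal.tsum_mul_left]
      gcongr
      refine (tsum_rpow_le_rpow_tsum _ ((one_le_div hp).2 hpq)).trans ?_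
      gcongr
      exact tsum_measure_doubleLayer_le ν κ hρ

/-- The weighted Hardy inequality for `q < p`. The half-mass estimate on each dyadic layer bounds
`μ (layer) ^ (r / q)` by the integral of `μ (Iic s) ^ (r / p)` over it, and Hölder's inequality with
exponents `p / q` and `r / q` sums over the layers. -/
theorem HolderBound.lintegral_rpow_tail_le_of_lt {p q r : ℝ} {D : ℝ → ℝ≥0∞} {ν κ : Measure X}
    {ρ : X → ℝ} (hD : HolderBound p D ν κ ρ) (hq : 0 < q) (hp : 0 < p) (hr : 0 < r)
    (hpqr : 1 / r = 1 / q - 1 / p) (hρ : Measurable ρ)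
    (hκ : κ univ ≠ ∞) {μ : Measure ℝ} (hμ : ∀ᵐ s ∂μ, D s ≠ ∞) :
    ∫⁻ s, tail ν ρ s ^ q ∂μ ≤
      2 * 4 ^ q * ((2 * κ univ) ^ (q / p) * (∫⁻ s, μ (Iic s) ^ (r / p) * D s ^ r ∂μ) ^ (q / r)) := by
  refine (lintegral_rpow_tail_le_tsum hq (hD.ae_tail_ne_top hp hρ hκ hμ)).trans ?_
  have hqp : r / q = r / p + 1 := by
    have : r * (1 / r) = r * (1 / q - 1 / p) := by rw [hpqr]
    rw [mul_one_div_cancel hr.ne'] at this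
    rw [this]; ring
  have hone : q / p + q / r = 1 := by
    have : q * (1 / r) = q * (1 / q - 1 / p) := by rw [hpqr]
    rw [mul_sub, mul_one_div_cancel hq.ne'] at this
    rw [div_eq_mul_one_div q r, this]; ring
  set a : ℤ → ℝ≥0∞ := fun k => ∫⁻ s in dyadicLayer ν ρ k, μ (Iic s) ^ (r / p) * D s ^ r ∂μ
  have hk : ∀ k : ℤ, ((2 : ℝ≥0∞) ^ (k + 1)) ^ q * μ (dyadicLayer ν ρ k) ≤
      2 * 4 ^ q * (κ (doubleLayer ν ρ k) ^ (q / p) * a k ^ (q / r)) := by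
    intro k
    have hE := measurableSet_dyadicLayer ν ρ k
    set N : ℝ≥0∞ := κ (doubleLayer ν ρ k) ^ (1 / p) with hN
    set b : ℝ≥0∞ := 2 ^ (k - 1)
    have hbt : b ≠ ∞ := two_zpow_ne_top _
    have hNt : N ≠ ∞ := ENNReal.rpow_ne_top_of_nonneg (by positivity)
      (ne_top_of_le_ne_top hκ (measure_mono (subset_univ _)))
    have h0 := rpow_measure_univ_le_lintegral (μ.restrict (dyadicLayer ν ρ k)) (a := r / p)
      (by positivity)
    rw [Measure.restrict_apply_univ, ← hqp] at h0
    have h1 : (b ^ q * μ (dyadicLayer ν ρ k)) ^ (r / q) ≤ 2 ^ (r / q) * (N ^ r * a k) := by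
      calc (b ^ q * μ (dyadicLayer ν ρ k)) ^ (r / q)
          = b ^ r * μ (dyadicLayer ν ρ k) ^ (r / q) := by
            rw [ENNReal.mul_rpow_of_nonneg _ _ (by positivity), ← ENNReal.rpow_mul,
              mul_div_cancel₀ _ hq.ne']
        _ ≤ b ^ r * (2 ^ (r / q) * ∫⁻ s in dyadicLayer ν ρ k,
              μ.restrict (dyadicLayer ν ρ k) (Iic s) ^ (r / p) ∂μ) := by gcongr
        _ = 2 ^ (r / q) * ∫⁻ s in dyadicLayer ν ρ k,
              b ^ r * μ.restrict (dyadicLayer ν ρ k) (Iic s) ^ (r / p) ∂μ := by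
            rw [lintegral_const_mul' _ _ (ENNReal.rpow_ne_top_of_nonneg hr.le hbt)]
            ring
        _ ≤ 2 ^ (r / q) * ∫⁻ s in dyadicLayer ν ρ k,
              N ^ r * (μ (Iic s) ^ (r / p) * D s ^ r) ∂μ := by
            refine mul_le_mul' le_rfl (lintegral_mono_ae ?_)
            filter_upwards [ae_restrict_of_ae hμ, ae_restrict_mem hE] with s hs1 hs3
            calc b ^ r * μ.restrict (dyadicLayer ν ρ k) (Iic s) ^ (r / p)
                ≤ (D s * N) ^ r * μ (Iic s) ^ (r / p) := by
                  gcongr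
                  · exact hD.two_zpow_le hp hρ hs3 hs1
                  · exact Measure.restrict_le_self
              _ = _ := by rw [ENNReal.mul_rpow_of_nonneg _ _ hr.le]; ring
        _ = _ := by rw [lintegral_const_mul' _ _ (ENNReal.rpow_ne_top_of_nonneg hr.le hNt)]
    have h2 : b ^ q * μ (dyadicLayer ν ρ k) ≤
        2 * (κ (doubleLayer ν ρ k) ^ (q / p) * a k ^ (q / r)) := by
      have h3 := ENNReal.rpow_le_rpow h1 (z := q / r) (by positivity)
      have e1 : r / q * (q / r) = 1 := by field_simp
      have e2 : 1 / p * (r * (q / r)) = q / p := by field_simp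
      rwa [← ENNReal.rpow_mul, e1, ENNReal.rpow_one, ENNReal.mul_rpow_of_nonneg _ _ (by positivity),
        ENNReal.mul_rpow_of_nonneg _ _ (by positivity), ← ENNReal.rpow_mul, e1, ENNReal.rpow_one,
        ← ENNReal.rpow_mul, hN, ← ENNReal.rpow_mul, e2] at h3
    rw [four_rpow_mul_two_zpow k hq]
    calc 4 ^ q * b ^ q * μ (dyadicLayer ν ρ k) = 4 ^ q * (b ^ q * μ (dyadicLayer ν ρ k)) := by ring
      _ ≤ 4 ^ q * (2 * (κ (doubleLayer ν ρ k) ^ (q / p) * a k ^ (q / r))) := by gcongr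
      _ = _ := by ring
  calc _ ≤ ∑' k, 2 * 4 ^ q * (κ (doubleLayer ν ρ k) ^ (q / p) * a k ^ (q / r)) :=
        ENNReal.tsum_le_tsum hk
    _ ≤ _ := by
      rw [ENNReal.tsum_mul_left]
      gcongr
      refine (tsum_rpow_mul_rpow_le _ _ (by positivity) (by positivity) hone).trans ?_
      gcongr
      · exact tsum_measure_doubleLayer_le ν κ hρ
      · rw [← lintegral_iUnion (measurableSet_dyadicLayer ν ρ) (pairwise_disjoint_dyadicLayer ν ρ)]
        exact setLIntegral_le_lintegral _ _

end

/-! ### Powers of a primitive and of a tail -/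

section

variable {X : Type*} [MeasurableSpace X]

/-- The lower bound of the tail of the test function `U(ρ) ^ a S(ρ) ^ b`, with `U(s) = μ (Iic s)` and
`S = tail ν ρ`: `U(ρ)` is monotone, and the power of the tail is handled by the half-mass estimate. -/
theorem rpow_mul_rpow_tail_le_lintegral (μ : Measure ℝ) (ν : Measure X) {ρ : X → ℝ}
    (hρ : Measurable ρ) {a b : ℝ} (ha : 0 ≤ a) (hb : 0 ≤ b) (s : ℝ) :
    μ (Iic s) ^ a * tail ν ρ s ^ (b + 1) ≤
      2 ^ (b + 1) * ∫⁻ x in {x | s ≤ ρ x}, μ (Iic (ρ x)) ^ a * tail ν ρ (ρ x) ^ b ∂ν := by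
  have hs : MeasurableSet {x | s ≤ ρ x} := hρ measurableSet_Ici
  have h := rpow_measure_univ_le_lintegral_superlevel (ν.restrict {x | s ≤ ρ x}) hρ hb
  rw [Measure.restrict_apply_univ] at h
  have hm : Measurable fun x => ν.restrict {x | s ≤ ρ x} {y | ρ x ≤ ρ y} ^ b :=
    (((measurable_tail _ ρ).comp hρ).pow_const b :)
  calc μ (Iic s) ^ a * tail ν ρ s ^ (b + 1)
      ≤ μ (Iic s) ^ a * (2 ^ (b + 1) *
          ∫⁻ x in {x | s ≤ ρ x}, ν.restrict {x | s ≤ ρ x} {y | ρ x ≤ ρ y} ^ b ∂ν) := by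
        exact mul_le_mul' le_rfl h
    _ = 2 ^ (b + 1) * ∫⁻ x in {x | s ≤ ρ x},
          μ (Iic s) ^ a * ν.restrict {x | s ≤ ρ x} {y | ρ x ≤ ρ y} ^ b ∂ν := by
        rw [lintegral_const_mul _ hm]; ring
    _ ≤ _ := by
        refine mul_le_mul' le_rfl (setLIntegral_mono' hs fun x hx => ?_)
        refine mul_le_mul' (ENNReal.rpow_le_rpow ?_ ha) (ENNReal.rpow_le_rpow ?_ hb)
        · exact measure_mono (Iic_subset_Iic.2 hx)
        · exact Measure.restrict_le_self _

/-- The upper bound of the norm of the test function. It replaces an integration by parts: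
`U ^ (a + 1)` is bounded by `∫ U ^ a dμ`, and the order of integration is exchanged. -/
theorem lintegral_rpow_mul_rpow_tail_le (μ : Measure ℝ) [SFinite μ] (ν : Measure X) [SFinite ν]
    {ρ : X → ℝ} (hρ : Measurable ρ) {a b : ℝ} (ha : 0 ≤ a) (hb : 0 ≤ b) :
    ∫⁻ x, μ (Iic (ρ x)) ^ (a + 1) * tail ν ρ (ρ x) ^ b ∂ν ≤
      2 ^ (a + 1) * ∫⁻ s, μ (Iic s) ^ a * tail ν ρ s ^ (b + 1) ∂μ := by
  have hU : Measurable fun s => μ (Iic s) ^ a := (measurable_measure_Iic μ).pow_const a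
  have hS : Measurable fun x => tail ν ρ (ρ x) ^ b :=
    ((measurable_tail ν ρ).comp hρ).pow_const b
  have hset : MeasurableSet {z : X × ℝ | z.2 ≤ ρ z.1} :=
    measurableSet_le measurable_snd (hρ.comp measurable_fst)
  have hK : Measurable fun z : X × ℝ =>
      {z : X × ℝ | z.2 ≤ ρ z.1}.indicator
        (fun z => μ (Iic z.2) ^ a * tail ν ρ (ρ z.1) ^ b) z :=
    ((hU.comp measurable_snd).mul (hS.comp measurable_fst)).indicator hset
  have hleft : ∀ x, μ (Iic (ρ x)) ^ (a + 1) * tail ν ρ (ρ x) ^ b ≤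
      2 ^ (a + 1) * ∫⁻ s, {z : X × ℝ | z.2 ≤ ρ z.1}.indicator
        (fun z => μ (Iic z.2) ^ a * tail ν ρ (ρ z.1) ^ b) (x, s) ∂μ := by
    intro x
    have h := rpow_measure_univ_le_lintegral (μ.restrict (Iic (ρ x))) ha
    rw [Measure.restrict_apply_univ] at h
    have e : ∀ s, {z : X × ℝ | z.2 ≤ ρ z.1}.indicator
        (fun z => μ (Iic z.2) ^ a * tail ν ρ (ρ z.1) ^ b) (x, s) =
        (Iic (ρ x)).indicator (fun s => μ (Iic s) ^ a * tail ν ρ (ρ x) ^ b) s := fun s => by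
      by_cases hs : s ≤ ρ x <;> simp [hs]
    simp_rw [e]
    rw [lintegral_indicator measurableSet_Iic, lintegral_mul_const _ hU, ← mul_assoc]
    refine mul_le_mul' (h.trans (mul_le_mul' le_rfl (lintegral_mono fun s => ?_))) le_rfl
    exact ENNReal.rpow_le_rpow (Measure.restrict_le_self _) ha
  have hright : ∀ s, ∫⁻ x, {z : X × ℝ | z.2 ≤ ρ z.1}.indicator
        (fun z => μ (Iic z.2) ^ a * tail ν ρ (ρ z.1) ^ b) (x, s) ∂ν ≤
      μ (Iic s) ^ a * tail ν ρ s ^ (b + 1) := by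
    intro s
    have hs : MeasurableSet {x | s ≤ ρ x} := hρ measurableSet_Ici
    have e : ∀ x, {z : X × ℝ | z.2 ≤ ρ z.1}.indicator
        (fun z => μ (Iic z.2) ^ a * tail ν ρ (ρ z.1) ^ b) (x, s) =
        {x | s ≤ ρ x}.indicator (fun x => μ (Iic s) ^ a * tail ν ρ (ρ x) ^ b) x := fun x => by
      by_cases hs : s ≤ ρ x <;> simp [hs]
    simp_rw [e]
    rw [lintegral_indicator hs, lintegral_const_mul _ hS]
    gcongr
    calc ∫⁻ x in {x | s ≤ ρ x}, tail ν ρ (ρ x) ^ b ∂ν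
        ≤ ∫⁻ _ in {x | s ≤ ρ x}, tail ν ρ s ^ b ∂ν :=
          setLIntegral_mono' hs fun x hx => ENNReal.rpow_le_rpow (antitone_tail ν ρ hx) hb
      _ = tail ν ρ s ^ (b + 1) := by
          rw [setLIntegral_const, ENNReal.rpow_add_of_nonneg _ _ hb zero_le_one, ENNReal.rpow_one]
          rfl
  calc _ ≤ ∫⁻ x, 2 ^ (a + 1) * ∫⁻ s, {z : X × ℝ | z.2 ≤ ρ z.1}.indicator
          (fun z => μ (Iic z.2) ^ a * tail ν ρ (ρ z.1) ^ b) (x, s) ∂μ ∂ν := lintegral_mono hleft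
    _ = 2 ^ (a + 1) * ∫⁻ s, ∫⁻ x, {z : X × ℝ | z.2 ≤ ρ z.1}.indicator
          (fun z => μ (Iic z.2) ^ a * tail ν ρ (ρ z.1) ^ b) (x, s) ∂ν ∂μ := by
        rw [lintegral_const_mul _ hK.lintegral_prod_right', lintegral_lintegral_swap hK.aemeasurable]
    _ ≤ _ := mul_le_mul' le_rfl (lintegral_mono hright)

end

/-! ### Duality for weighted norms -/

section

section Truncation
variable {X : Type*} [MeasurableSpace X]

/-- The truncation of `w` at height `k` and to a set of finite measure, increasing to `w`. -/
noncomputable def trunc (m : Measure X) [SigmaFinite m] (w : X → ℝ≥0∞) (k : ℕ) : X → ℝ≥0∞ :=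
  (spanningSets m k).indicator fun x => min (w x) k

variable (m : Measure X) [SigmaFinite m] (w : X → ℝ≥0∞)

theorem trunc_le (k : ℕ) (x : X) : trunc m w k x ≤ w x :=
  indicator_apply_le' (fun _ => min_le_left _ _) fun _ => zero_le

theorem trunc_le_indicator (k : ℕ) (x : X) :
    trunc m w k x ≤ (spanningSets m k).indicator (fun _ => (k : ℝ≥0∞)) x :=
  indicator_le_indicator (min_le_right _ _)

theorem monotone_trunc (x : X) : Monotone fun k => trunc m w k x := by
  intro i j hij
  refine indicator_apply_le' (fun hx => ?_) fun _ => zero_le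
  have hx' := monotone_spanningSets m hij hx
  simp only [trunc, indicator_of_mem hx']
  gcongr

theorem iSup_trunc (x : X) : ⨆ k, trunc m w k x = w x := by
  refine le_antisymm (iSup_le fun k => trunc_le m w k x) (le_of_forall_lt fun a ha => ?_)
  obtain ⟨i, hi⟩ := ENNReal.exists_nat_gt ha.ne_top
  refine lt_of_lt_of_le ?_ (le_iSup _ (max i (spanningSetsIndex m x)))
  have hx := monotone_spanningSets m (le_max_right i _) (mem_spanningSetsIndex m x)
  simp only [trunc, indicator_of_mem hx]
  refine lt_min ha (hi.trans_le ?_)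
  exact_mod_cast le_max_left _ _

theorem lintegral_trunc_ne_top (k : ℕ) : ∫⁻ x, trunc m w k x ∂m ≠ ∞ := by
  refine ne_top_of_le_ne_top ?_ (lintegral_mono (trunc_le_indicator m w k))
  rw [lintegral_indicator_const (measurableSet_spanningSets m k)]
  exact ENNReal.mul_ne_top (ENNReal.natCast_ne_top k) (measure_spanningSets_lt_top m k).ne

variable {w} in
theorem aemeasurable_trunc (hw : AEMeasurable w m) (k : ℕ) : AEMeasurable (trunc m w k) m :=
  (hw.min aemeasurable_const).indicator (measurableSet_spanningSets m k)

variable {w} in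
theorem iSup_setLIntegral_trunc (hw : AEMeasurable w m) (s : Set X) :
    ⨆ k, ∫⁻ x in s, trunc m w k x ∂m = ∫⁻ x in s, w x ∂m := by
  rw [← lintegral_iSup' (fun k => (aemeasurable_trunc m hw k).restrict)
    (Filter.Eventually.of_forall fun x => monotone_trunc m w x)]
  simp_rw [iSup_trunc]

end Truncation

theorem wNorm_of_ne_top {X : Type*} [MeasureSpace X] {p : ℝ≥0∞} (hp : p ≠ ∞) (w : X → ℝ≥0∞)
    (Ω : Set X) (f : X → ℝ≥0∞) :
    wNorm p w Ω f = (∫⁻ x in Ω, f x ^ p.toReal * w x) ^ (1 / p.toReal) := if_neg hp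

theorem wNorm_top {X : Type*} [MeasureSpace X] (w : X → ℝ≥0∞) (Ω : Set X) (f : X → ℝ≥0∞) :
    wNorm ∞ w Ω f = essSup (fun x => f x * w x) (volume.restrict Ω) := if_pos rfl

section Euclidean
variable {n : ℕ}

theorem coBall_eq (n : ℕ) (t : ℝ) : coBall n t = {x | t ≤ ‖x‖} := by
  ext x
  simp [coBall]

theorem measurableSet_coBall (n : ℕ) (t : ℝ) : MeasurableSet (coBall n t) :=
  measurableSet_ball.compl

theorem antitone_coBall (n : ℕ) : Antitone (coBall n) :=
  fun _ _ h => compl_subset_compl.2 (Metric.ball_subset_ball h)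

theorem tail_withDensity (f : EuclideanSpace ℝ (Fin n) → ℝ≥0∞) (t : ℝ) :
    tail (volume.withDensity f) norm t = ∫⁻ x in coBall n t, f x := by
  rw [tail, ← coBall_eq, withDensity_apply _ (measurableSet_coBall n t)]

theorem volume_coBall (hn : 1 ≤ n) (t : ℝ) : volume (coBall n t) = ∞ := by
  have : Nonempty (Fin n) := ⟨⟨0, hn⟩⟩
  have h : volume (univ : Set (EuclideanSpace ℝ (Fin n))) ≤
      volume (Metric.ball (0 : EuclideanSpace ℝ (Fin n)) t) + volume (coBall n t) := by
    rw [← union_compl_self (Metric.ball (0 : EuclideanSpace ℝ (Fin n)) t)]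
    exact measure_union_le _ _
  have := NormedSpace.noncompactSpace ℝ (EuclideanSpace ℝ (Fin n))
  by_contra hne
  rw [measure_univ_of_isAddLeftInvariant, top_le_iff] at h
  exact ENNReal.add_ne_top.2 ⟨measure_ball_lt_top.ne, hne⟩ h

variable {v : EuclideanSpace ℝ (Fin n) → ℝ≥0} {p : ℝ≥0∞}

/-- For `1 < p < ∞` the function `v ^ (1 - p')`, whose integral over `ℝⁿ ∖ B(0,t)` is
`dualNorm p v t ^ p'`. -/
noncomputable def dualDensity (p : ℝ≥0∞) (v : EuclideanSpace ℝ (Fin n) → ℝ≥0)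
    (x : EuclideanSpace ℝ (Fin n)) : ℝ≥0∞ :=
  ((v x : ℝ≥0∞) ^ (-1 / p.toReal)) ^ p.conjExponent.toReal

theorem conjExponent_ne_top (hp : 1 < p) : p.conjExponent ≠ ∞ := by
  have := ENNReal.HolderConjugate.conjExponent hp.le
  rw [ENNReal.HolderConjugate.ne_top_iff_ne_one _ p]
  exact hp.ne'

theorem holderConjugate_toReal (hp : 1 < p) (hp' : p ≠ ∞) :
    p.toReal.HolderConjugate p.conjExponent.toReal := by
  have := ENNReal.HolderConjugate.conjExponent hp.le
  exact ENNReal.HolderConjugate.toReal_of_ne_top hp' (conjExponent_ne_top hp)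

theorem dualNorm_eq (hp : 1 < p) (t : ℝ) :
    dualNorm p v t = (∫⁻ x in coBall n t, dualDensity p v x) ^ (1 / p.conjExponent.toReal) := by
  simp only [dualNorm, lpNorm, wNorm_of_ne_top (conjExponent_ne_top hp), mul_one, dualDensity]

theorem dualNorm_one (t : ℝ) :
    dualNorm 1 v t = essSup (fun x => (v x : ℝ≥0∞)⁻¹) (volume.restrict (coBall n t)) := by
  have : (1 : ℝ≥0∞).conjExponent = ∞ := by simp [ENNReal.conjExponent]
  simp [dualNorm, lpNorm, this, wNorm_top, ENNReal.rpow_neg_one]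

theorem dualNormTop_eq (t : ℝ) : dualNormTop v t = ∫⁻ x in coBall n t, (v x : ℝ≥0∞)⁻¹ := by
  simp [dualNormTop, lpNorm, wNorm_of_ne_top]

theorem aemeasurable_dualDensity (hv : AEMeasurable fun x => (v x : ℝ≥0∞)) :
    AEMeasurable (dualDensity p v) := (hv.pow_const _).pow_const _

/-- `h ^ p v ≤ h` for every `h ≤ v ^ (1 - p')`. -/
theorem rpow_mul_le_of_le_dualDensity (hp : 1 < p) (hp' : p ≠ ∞)
    {x : EuclideanSpace ℝ (Fin n)} {h : ℝ≥0∞} (hle : h ≤ dualDensity p v x) :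
    h ^ p.toReal * v x ≤ h := by
  have hc := holderConjugate_toReal hp hp'
  have hσ : dualDensity p v x ^ (p.toReal - 1) = (v x : ℝ≥0∞)⁻¹ := by
    rw [dualDensity, ← ENNReal.rpow_mul, ← ENNReal.rpow_mul, ← ENNReal.rpow_neg_one]
    congr 1
    have h1 := hc.sub_one_mul_conj
    have h2 := hc.ne_zero
    rw [mul_comm p.conjExponent.toReal, h1, div_mul_cancel₀ _ h2]
  calc h ^ p.toReal * v x = h * h ^ (p.toReal - 1) * v x := by
        rw [← rpow_eq_mul_rpow_sub_one _ hc.lt.le]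
    _ ≤ h * (v x : ℝ≥0∞)⁻¹ * v x := by
        rw [← hσ]
        gcongr
        exact hc.sub_one_pos.le
    _ = h * ((v x : ℝ≥0∞)⁻¹ * v x) := mul_assoc _ _ _
    _ ≤ h * 1 := by gcongr; exact ENNReal.inv_mul_le_one _
    _ = h := mul_one h

/-- Hölder's inequality. It is restricted to finite dual norms, as `∞ · 0 = 0` would make it fail when
`v` vanishes on a set of positive measure. -/
theorem holderBound_dualNorm (hp : 1 ≤ p) (hp' : p ≠ ∞) (hv : AEMeasurable fun x => (v x : ℝ≥0∞))
    {f : EuclideanSpace ℝ (Fin n) → ℝ≥0∞} (hf : AEMeasurable f) :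
    HolderBound p.toReal (dualNorm p v) (volume.withDensity f)
      (volume.withDensity fun x => f x ^ p.toReal * v x) norm := by
  intro t ht A hA hAt
  rw [← coBall_eq] at hAt
  rw [withDensity_apply _ hA, withDensity_apply _ hA]
  rcases hp.eq_or_lt with rfl | hp1
  · have hae : ∀ᵐ x ∂volume.restrict A, (v x : ℝ≥0∞)⁻¹ ≤ dualNorm 1 v t := by
      rw [dualNorm_one]
      exact ae_restrict_of_ae_restrict_of_subset hAt (ENNReal.ae_le_essSup _)
    rw [ENNReal.toReal_one, div_one, ENNReal.rpow_one, ← lintegral_const_mul' _ _ ht]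
    refine lintegral_mono_ae (hae.mono fun x hx => ?_)
    have h0 : (v x : ℝ≥0∞) ≠ 0 := fun h => by
      rw [h, ENNReal.inv_zero, top_le_iff] at hx
      exact ht hx
    calc f x = (v x : ℝ≥0∞)⁻¹ * (f x * v x) := by
          rw [mul_left_comm, ENNReal.inv_mul_cancel h0 ENNReal.coe_ne_top, mul_one]
      _ ≤ _ := by rw [ENNReal.rpow_one]; gcongr
  · have hc := holderConjugate_toReal hp1 hp'
    have hint : ∫⁻ x in coBall n t, dualDensity p v x ≠ ∞ := by
      intro h
      rw [dualNorm_eq hp1, h, ENNReal.top_rpow_of_pos (one_div_pos.2 hc.symm.pos)] at ht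
      exact ht rfl
    have hae : ∀ᵐ x ∂volume.restrict A, dualDensity p v x < ∞ :=
      ae_restrict_of_ae_restrict_of_subset hAt
        (ae_lt_top' (aemeasurable_dualDensity hv).restrict hint)
    calc ∫⁻ x in A, f x
        = ∫⁻ x in A, ((fun x => (v x : ℝ≥0∞) ^ (-1 / p.toReal)) *
            fun x => f x * (v x : ℝ≥0∞) ^ (1 / p.toReal)) x := by
          refine lintegral_congr_ae (hae.mono fun x hx => ?_)
          have h0 : (v x : ℝ≥0∞) ≠ 0 := fun h => by
            rw [dualDensity, h, ENNReal.zero_rpow_of_neg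
              (div_neg_of_neg_of_pos (by norm_num) hc.pos),
              ENNReal.top_rpow_of_pos hc.symm.pos] at hx
            exact hx.ne rfl
          simp only [Pi.mul_apply]
          rw [mul_left_comm, ← ENNReal.rpow_add _ _ h0 ENNReal.coe_ne_top, ← add_div]
          simp
      _ ≤ (∫⁻ x in A, dualDensity p v x) ^ (1 / p.conjExponent.toReal) *
            (∫⁻ x in A, (f x * (v x : ℝ≥0∞) ^ (1 / p.toReal)) ^ p.toReal) ^ (1 / p.toReal) :=
          ENNReal.lintegral_mul_le_Lp_mul_Lq _ hc.symm (hv.pow_const _).restrict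
            (hf.mul (hv.pow_const _)).restrict
      _ ≤ _ := by
          rw [dualNorm_eq hp1]
          have e : ∀ x, (f x * (v x : ℝ≥0∞) ^ (1 / p.toReal)) ^ p.toReal =
              f x ^ p.toReal * v x := fun x => by
            rw [ENNReal.mul_rpow_of_nonneg _ _ hc.nonneg, ← ENNReal.rpow_mul,
              one_div_mul_cancel hc.ne_zero, ENNReal.rpow_one]
          simp_rw [e]
          gcongr

/-- The converse of Hölder's inequality. -/
theorem exists_lintegral_coBall_ge (hp : 1 ≤ p) (hp' : p ≠ ∞)
    (hv : AEMeasurable fun x => (v x : ℝ≥0∞)) {t : ℝ} {M : ℝ≥0∞} (hM : M < dualNorm p v t) :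
    ∃ f : EuclideanSpace ℝ (Fin n) → ℝ≥0∞, AEMeasurable f ∧
      wNorm p (fun x => (v x : ℝ≥0∞)) univ f ≤ 1 ∧ M ≤ ∫⁻ x in coBall n t, f x := by
  rcases hp.eq_or_lt with rfl | hp1
  · rw [dualNorm_one] at hM
    set S : Set (EuclideanSpace ℝ (Fin n)) := {x | M < (v x : ℝ≥0∞)⁻¹} with hS
    have hpos : (volume.restrict (coBall n t)) S ≠ 0 := by
      intro h0
      refine hM.not_ge (essSup_le_of_ae_le M ?_)
      have : ∀ᵐ x ∂volume.restrict (coBall n t), x ∉ S := measure_eq_zero_iff_ae_notMem.1 h0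
      exact this.mono fun x hx => not_lt.1 hx
    have hSm : NullMeasurableSet S (volume.restrict (coBall n t)) :=
      (nullMeasurableSet_lt aemeasurable_const hv.inv).mono_ac Measure.absolutelyContinuous_restrict
    obtain ⟨E, hES, hE, hEpos, hEfin⟩ : ∃ E ⊆ S, MeasurableSet E ∧
        volume.restrict (coBall n t) E ≠ 0 ∧ volume.restrict (coBall n t) E ≠ ∞ := by
      obtain ⟨S', hS'S, hS', hS'eq⟩ := hSm.exists_measurable_subset_ae_eq
      obtain ⟨E, hE1, hE2, hE3, hE4⟩ := Measure.exists_subset_measure_lt_top hS'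
        (r := 0) (μ := volume.restrict (coBall n t))
        (by rw [measure_congr hS'eq]; exact pos_iff_ne_zero.2 hpos)
      exact ⟨E, hE2.trans hS'S, hE1, hE3.ne', hE4.ne⟩
    rw [Measure.restrict_apply hE] at hEpos hEfin
    have hEm := hE.inter (measurableSet_coBall n t)
    refine ⟨(E ∩ coBall n t).indicator fun _ => M * (volume (E ∩ coBall n t))⁻¹,
      (measurable_const.indicator hEm).aemeasurable, ?_, ?_⟩
    · rw [wNorm_of_ne_top ENNReal.one_ne_top]
      simp only [ENNReal.toReal_one, div_one, ENNReal.rpow_one, Measure.restrict_univ]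
      calc ∫⁻ x, (E ∩ coBall n t).indicator (fun _ => M * (volume (E ∩ coBall n t))⁻¹) x * v x
          ≤ ∫⁻ x, (E ∩ coBall n t).indicator (fun _ => (volume (E ∩ coBall n t))⁻¹) x := by
            refine lintegral_mono fun x => ?_
            by_cases hx : x ∈ E ∩ coBall n t
            · simp only [indicator_of_mem hx]
              have h1 : M * (v x : ℝ≥0∞) ≤ 1 := by
                calc M * (v x : ℝ≥0∞) ≤ (v x : ℝ≥0∞)⁻¹ * v x := by
                      gcongr; exact (show M < _ from hES hx.1).le
                  _ ≤ 1 := ENNReal.inv_mul_le_one _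
              calc M * (volume (E ∩ coBall n t))⁻¹ * v x
                  = M * v x * (volume (E ∩ coBall n t))⁻¹ := by ring
                _ ≤ 1 * (volume (E ∩ coBall n t))⁻¹ := by gcongr
                _ = _ := one_mul _
            · simp [indicator_of_notMem hx]
        _ = 1 := by
            rw [lintegral_indicator_const hEm, ENNReal.inv_mul_cancel hEpos hEfin]
    · rw [setLIntegral_indicator hEm, inter_assoc, inter_self, setLIntegral_const, mul_assoc,
        ENNReal.inv_mul_cancel hEpos hEfin, mul_one]
  · have hc := holderConjugate_toReal hp1 hp'
    have hcp := hc.symm.pos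
    have hσ := aemeasurable_dualDensity (p := p) hv
    rw [dualNorm_eq hp1, one_div, ENNReal.lt_rpow_inv_iff hcp, ← iSup_setLIntegral_trunc volume hσ,
      lt_iSup_iff] at hM
    obtain ⟨k, hk⟩ := hM
    set h := trunc volume (dualDensity p v) k
    set S : ℝ≥0∞ := ∫⁻ x in coBall n t, h x with hS
    have hS0 : S ≠ 0 := (zero_le.trans_lt hk).ne'
    have hSt : S ≠ ∞ := ne_top_of_le_ne_top (lintegral_trunc_ne_top volume _ k)
      (setLIntegral_le_lintegral _ _)
    have hhm : AEMeasurable h := aemeasurable_trunc volume hσ k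
    have hct : S ^ (-1 / p.toReal) ≠ ∞ := ENNReal.rpow_ne_top_of_ne_zero hS0 hSt
    refine ⟨(coBall n t).indicator fun x => S ^ (-1 / p.toReal) * h x,
      (hhm.const_mul _).indicator (measurableSet_coBall n t), ?_, ?_⟩
    · rw [wNorm_of_ne_top hp', Measure.restrict_univ]
      refine ENNReal.rpow_le_one ?_ (one_div_nonneg.2 hc.nonneg)
      calc ∫⁻ x, (coBall n t).indicator (fun x => S ^ (-1 / p.toReal) * h x) x ^ p.toReal * v x
          ≤ ∫⁻ x, (coBall n t).indicator (fun x => S⁻¹ * h x) x := by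
            refine lintegral_mono fun x => ?_
            by_cases hx : x ∈ coBall n t
            · simp only [indicator_of_mem hx]
              rw [ENNReal.mul_rpow_of_nonneg _ _ hc.nonneg, ← ENNReal.rpow_mul,
                div_mul_cancel₀ _ hc.ne_zero, ENNReal.rpow_neg_one, mul_assoc]
              gcongr
              exact rpow_mul_le_of_le_dualDensity hp1 hp' (trunc_le _ _ _ _)
            · simp [indicator_of_notMem hx, hc.pos]
        _ = 1 := by
            rw [lintegral_indicator (measurableSet_coBall n t),
              lintegral_const_mul' _ _ (ENNReal.inv_ne_top.2 hS0), ENNReal.inv_mul_cancel hS0 hSt]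
    · rw [setLIntegral_indicator (measurableSet_coBall n t), inter_self,
        lintegral_const_mul' _ _ hct]
      calc M ≤ S ^ (1 / p.conjExponent.toReal) := by
            rw [one_div, ENNReal.le_rpow_inv_iff hcp]; exact hk.le
        _ = S ^ (-1 / p.toReal) * S := by
            have e : 1 / p.conjExponent.toReal = -1 / p.toReal + 1 := by
              have := hc.inv_add_inv_eq_one
              rw [one_div, neg_div, one_div]; linarith
            rw [e, ENNReal.rpow_add _ _ hS0 hSt, ENNReal.rpow_one]

theorem antitone_dualNorm (hp : 1 ≤ p) : Antitone (dualNorm p v) := by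
  intro s t hst
  rcases hp.eq_or_lt with rfl | hp1
  · rw [dualNorm_one, dualNorm_one]
    exact essSup_mono_measure' (Measure.restrict_mono (antitone_coBall n hst) le_rfl)
  · rw [dualNorm_eq hp1, dualNorm_eq hp1]
    exact ENNReal.rpow_le_rpow (lintegral_mono_set (antitone_coBall n hst)) (by positivity)

theorem dualNorm_ne_zero (hn : 1 ≤ n) (hp : 1 ≤ p) (hp' : p ≠ ∞)
    (hv : AEMeasurable fun x => (v x : ℝ≥0∞)) (t : ℝ) : dualNorm p v t ≠ 0 := by
  intro h
  have hvol : volume.restrict (coBall n t) ≠ 0 := fun h0 => by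
    have := volume_coBall hn t
    rw [← Measure.restrict_apply_univ, h0] at this
    simp at this
  have : (ae (volume.restrict (coBall n t))).NeBot := ae_neBot.2 hvol
  rcases hp.eq_or_lt with rfl | hp1
  · rw [dualNorm_one, ENNReal.essSup_eq_zero_iff] at h
    obtain ⟨x, hx⟩ := h.exists
    simp at hx
  · have hc := holderConjugate_toReal hp1 hp'
    rw [dualNorm_eq hp1, ENNReal.rpow_eq_zero_iff_of_pos (one_div_pos.2 hc.symm.pos),
      lintegral_eq_zero_iff' (aemeasurable_dualDensity hv).restrict] at h
    obtain ⟨x, hx⟩ := h.exists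
    simp only [dualDensity, Pi.zero_apply, ENNReal.rpow_eq_zero_iff_of_pos hc.symm.pos,
      ENNReal.rpow_eq_zero_iff, ENNReal.coe_ne_top, false_and, or_false] at hx
    have := div_neg_of_neg_of_pos (show (-1 : ℝ) < 0 by norm_num) hc.pos
    linarith [hx.2]

theorem dualNormTop_ne_zero (hn : 1 ≤ n) (hv : AEMeasurable fun x => (v x : ℝ≥0∞)) (t : ℝ) :
    dualNormTop v t ≠ 0 := by
  intro h
  have hvol : volume.restrict (coBall n t) ≠ 0 := fun h0 => by
    have := volume_coBall hn t
    rw [← Measure.restrict_apply_univ, h0] at this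
    simp at this
  have : (ae (volume.restrict (coBall n t))).NeBot := ae_neBot.2 hvol
  have hm : AEMeasurable (fun x => (v x : ℝ≥0∞)⁻¹) (volume.restrict (coBall n t)) :=
    hv.inv.restrict
  rw [dualNormTop_eq, lintegral_eq_zero_iff' hm] at h
  obtain ⟨x, hx⟩ := h.exists
  simp at hx

end Euclidean

end

/-! ### Lower bounds of the constant -/

section

variable {n : ℕ}

/-- The measure `w dt` on `Ω`. -/
noncomputable def densityOn (Ω : Set ℝ) (w : ℝ → ℝ≥0∞) : Measure ℝ :=
  (volume.restrict Ω).withDensity w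

theorem lintegral_densityOn {Ω : Set ℝ} {w g : ℝ → ℝ≥0∞}
    (hw : AEMeasurable w (volume.restrict Ω)) (hg : Measurable g) :
    ∫⁻ s, g s ∂densityOn Ω w = ∫⁻ s in Ω, w s * g s :=
  lintegral_withDensity_eq_lintegral_mul₀ hw hg.aemeasurable

theorem densityOn_univ (Ω : Set ℝ) (w : ℝ → ℝ≥0∞) : densityOn Ω w univ = ∫⁻ s in Ω, w s := by
  rw [densityOn, withDensity_apply _ MeasurableSet.univ, Measure.restrict_univ]

theorem densityOn_Iic {Ω : Set ℝ} (w : ℝ → ℝ≥0∞) {s : ℝ} (h : Iic s ∩ Ω = Ioc 0 s) :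
    densityOn Ω w (Iic s) = ∫⁻ y in Ioo 0 s, w y := by
  rw [densityOn, withDensity_apply _ measurableSet_Iic, Measure.restrict_restrict measurableSet_Iic,
    h, setLIntegral_congr Ioo_ae_eq_Ioc]

theorem Iic_inter_Ioi_zero (s : ℝ) : Iic s ∩ Ioi 0 = Ioc 0 s := by
  ext y
  simp [and_comm]

theorem Iic_inter_Ioo_zero {s t : ℝ} (h : s < t) : Iic s ∩ Ioo 0 t = Ioc 0 s := by
  ext y
  simp only [mem_inter_iff, mem_Iic, mem_Ioo, mem_Ioc]
  constructor
  · rintro ⟨h1, h2, -⟩; exact ⟨h2, h1⟩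
  · rintro ⟨h1, h2⟩; exact ⟨h2, h1, h2.trans_lt h⟩

theorem ae_densityOn_mem {Ω : Set ℝ} (hΩ : MeasurableSet Ω) (w : ℝ → ℝ≥0∞) :
    ∀ᵐ s ∂densityOn Ω w, s ∈ Ω :=
  withDensity_absolutelyContinuous _ w (ae_restrict_mem hΩ)

theorem monotone_primitive (u : ℝ → ℝ≥0) : Monotone (primitive u) := fun _ _ h =>
  lintegral_mono_set (Ioo_subset_Ioo_right h)

theorem ae_densityOn_Ioi_primitive_ne_zero (u : ℝ → ℝ≥0) :
    ∀ᵐ s ∂densityOn (Ioi 0) fun s => (u s : ℝ≥0∞), s ∈ Ioi (0 : ℝ) ∧ primitive u s ≠ 0 := by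
  filter_upwards [ae_densityOn_mem measurableSet_Ioi _, ae_measure_Iic_ne_zero _] with s hs hs'
  rw [densityOn_Iic _ (Iic_inter_Ioi_zero s)] at hs'
  exact ⟨hs, hs'⟩

theorem ae_densityOn_Ioo_primitive_ne_zero (u : ℝ → ℝ≥0) (t : ℝ) :
    ∀ᵐ s ∂densityOn (Ioo 0 t) fun s => (u s : ℝ≥0∞), s ∈ Ioo 0 t ∧ primitive u s ≠ 0 := by
  filter_upwards [ae_densityOn_mem measurableSet_Ioo _, ae_measure_Iic_ne_zero _] with s hs hs'
  rw [densityOn_Iic _ (Iic_inter_Ioo_zero hs.2)] at hs'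
  exact ⟨hs, hs'⟩

theorem antitone_setLIntegral_coBall (f : EuclideanSpace ℝ (Fin n) → ℝ≥0∞) :
    Antitone fun t => ∫⁻ x in coBall n t, f x :=
  fun _ _ h => lintegral_mono_set (antitone_coBall n h)

theorem measurable_setLIntegral_coBall (f : EuclideanSpace ℝ (Fin n) → ℝ≥0∞) :
    Measurable fun t => ∫⁻ x in coBall n t, f x :=
  (antitone_setLIntegral_coBall f).measurable

variable {p₁ p₂ q : ℝ≥0∞} {u : ℝ → ℝ≥0} {v₁ v₂ : EuclideanSpace ℝ (Fin n) → ℝ≥0}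

/-- Testing the bilinear inequality with functions `f` that nearly attain the dual norm on
`ℝⁿ ∖ B(0,t)`; on `(0,t)` one has `∫_{ℝⁿ ∖ B(0,·)} f ≥ ∫_{ℝⁿ ∖ B(0,t)} f`. -/
theorem HardyIneq.dualNorm_mul_le {C : ℝ≥0} (hC : HardyIneq p₁ p₂ q u v₁ v₂ C) (hp₁ : 1 ≤ p₁)
    (hp₁' : p₁ ≠ ∞) (hq : 0 < q.toReal) (hq' : q ≠ ∞) (hv₁ : AEMeasurable fun x => (v₁ x : ℝ≥0∞))
    {g : EuclideanSpace ℝ (Fin n) → ℝ≥0∞} (hg : AEMeasurable g) (t : ℝ) :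
    dualNorm p₁ v₁ t *
        (∫⁻ s in Ioo 0 t, u s * (∫⁻ x in coBall n s, g x) ^ q.toReal) ^ (1 / q.toReal) ≤
      C * wNorm p₂ (fun x => (v₂ x : ℝ≥0∞)) univ g := by
  refine ENNReal.mul_le_of_forall_lt fun M hM b hb => ?_
  obtain ⟨f, hf, hf1, hMf⟩ := exists_lintegral_coBall_ge hp₁ hp₁' hv₁ hM
  have hMq : M ^ q.toReal ≠ ∞ := ENNReal.rpow_ne_top_of_nonneg hq.le hM.ne_top
  calc M * b ≤ M * (∫⁻ s in Ioo 0 t, u s * (∫⁻ x in coBall n s, g x) ^ q.toReal) ^ (1 / q.toReal) :=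
        mul_le_mul' le_rfl hb.le
    _ = (∫⁻ s in Ioo 0 t, M ^ q.toReal * (u s * (∫⁻ x in coBall n s, g x) ^ q.toReal)) ^
          (1 / q.toReal) := by
        rw [lintegral_const_mul' _ _ hMq, ENNReal.mul_rpow_of_nonneg _ _ (by positivity),
          ← ENNReal.rpow_mul, mul_one_div_cancel hq.ne', ENNReal.rpow_one]
    _ ≤ (∫⁻ s in Ioi 0, ((∫⁻ x in coBall n s, f x) * ∫⁻ x in coBall n s, g x) ^ q.toReal * u s) ^
          (1 / q.toReal) := by
        refine ENNReal.rpow_le_rpow ?_ (by positivity)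
        refine (setLIntegral_mono' measurableSet_Ioo fun s hs => ?_).trans
          (lintegral_mono_set Ioo_subset_Ioi_self)
        have hs' : M ≤ ∫⁻ x in coBall n s, f x :=
          hMf.trans (antitone_setLIntegral_coBall f hs.2.le)
        rw [ENNReal.mul_rpow_of_nonneg _ _ hq.le, mul_comm (u s : ℝ≥0∞), ← mul_assoc]
        gcongr
    _ ≤ C * wNorm p₁ (fun x => (v₁ x : ℝ≥0∞)) univ f * wNorm p₂ (fun x => (v₂ x : ℝ≥0∞)) univ g := by
        rw [← wNorm_of_ne_top hq']
        exact hC f g hf hg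
    _ ≤ C * 1 * wNorm p₂ (fun x => (v₂ x : ℝ≥0∞)) univ g := by gcongr
    _ = _ := by rw [mul_one]

/-- Necessity for `p₂ ≤ q`. The estimate holds for every finite `p₂`, and shows for `q < p₂` that the
primitive of `u` is finite. -/
theorem HardyIneq.primitive_mul_dualNorm_le {C : ℝ≥0} (hC : HardyIneq p₁ p₂ q u v₁ v₂ C)
    (hp₁ : 1 ≤ p₁) (hp₁' : p₁ ≠ ∞) (hp₂ : 1 ≤ p₂) (hp₂' : p₂ ≠ ∞) (hq : 0 < q.toReal) (hq' : q ≠ ∞)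
    (hv₁ : AEMeasurable fun x => (v₁ x : ℝ≥0∞)) (hv₂ : AEMeasurable fun x => (v₂ x : ℝ≥0∞)) (t : ℝ) :
    primitive u t ^ (1 / q.toReal) * dualNorm p₁ v₁ t * dualNorm p₂ v₂ t ≤ C := by
  refine ENNReal.mul_le_of_forall_lt fun b hb M hM => ?_
  obtain ⟨g, hg, hg1, hMg⟩ := exists_lintegral_coBall_ge hp₂ hp₂' hv₂ hM
  have hMq : M ^ q.toReal ≠ ∞ := ENNReal.rpow_ne_top_of_nonneg hq.le hM.ne_top
  calc b * M ≤ primitive u t ^ (1 / q.toReal) * dualNorm p₁ v₁ t * M := by gcongr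
    _ = dualNorm p₁ v₁ t * (∫⁻ s in Ioo 0 t, M ^ q.toReal * u s) ^ (1 / q.toReal) := by
        rw [lintegral_const_mul' _ _ hMq, ENNReal.mul_rpow_of_nonneg _ _ (by positivity),
          ← ENNReal.rpow_mul, mul_one_div_cancel hq.ne', ENNReal.rpow_one, primitive]
        ring
    _ ≤ dualNorm p₁ v₁ t *
        (∫⁻ s in Ioo 0 t, u s * (∫⁻ x in coBall n s, g x) ^ q.toReal) ^ (1 / q.toReal) := by
        gcongr dualNorm p₁ v₁ t * ?_ ^ _
        refine setLIntegral_mono' measurableSet_Ioo fun s hs => ?_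
        rw [mul_comm]
        gcongr
        exact hMg.trans (antitone_setLIntegral_coBall g hs.2.le)
    _ ≤ C * wNorm p₂ (fun x => (v₂ x : ℝ≥0∞)) univ g := hC.dualNorm_mul_le hp₁ hp₁' hq hq' hv₁ hg t
    _ ≤ C * 1 := by gcongr
    _ = C := mul_one _

theorem rpow_iSup_eq {ι : Sort*} (f : ι → ℝ≥0∞) {a : ℝ} (ha : 0 < a) :
    (⨆ i, f i) ^ a = ⨆ i, f i ^ a :=
  (ENNReal.orderIsoRpow a ha).map_iSup f

/-- The lower bound of `C` for `p₂ = ∞`: the extremal functions `g` are the truncations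
of `v₂⁻¹`. -/
theorem HardyIneq.dualNorm_mul_lintegral_dualNormTop_le {C : ℝ≥0}
    (hC : HardyIneq p₁ ∞ q u v₁ v₂ C)
    (hp₁ : 1 ≤ p₁) (hp₁' : p₁ ≠ ∞) (hq : 0 < q.toReal) (hq' : q ≠ ∞)
    (hu : AEMeasurable (fun t => (u t : ℝ≥0∞)) (volume.restrict (Ioi 0)))
    (hv₁ : AEMeasurable fun x => (v₁ x : ℝ≥0∞)) (hv₂ : AEMeasurable fun x => (v₂ x : ℝ≥0∞)) (t : ℝ) :
    dualNorm p₁ v₁ t * (∫⁻ y in Ioo 0 t, u y * dualNormTop v₂ y ^ q.toReal) ^ (1 / q.toReal) ≤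
      C := by
  have hw : AEMeasurable (fun x => (v₂ x : ℝ≥0∞)⁻¹) := hv₂.inv
  set h : ℕ → EuclideanSpace ℝ (Fin n) → ℝ≥0∞ := trunc volume fun x => (v₂ x : ℝ≥0∞)⁻¹ with hh
  have hsup : ∫⁻ y in Ioo 0 t, u y * dualNormTop v₂ y ^ q.toReal =
      ⨆ k, ∫⁻ y in Ioo 0 t, u y * (∫⁻ x in coBall n y, h k x) ^ q.toReal := by
    rw [← lintegral_iSup']
    · simp_rw [dualNormTop_eq, ← iSup_setLIntegral_trunc volume hw, rpow_iSup_eq _ hq,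
        ENNReal.mul_iSup, hh]
    · exact fun k => (hu.mono_set Ioo_subset_Ioi_self).mul
        ((measurable_setLIntegral_coBall _).pow_const _).aemeasurable
    · refine Filter.Eventually.of_forall fun y i j hij => ?_
      refine mul_le_mul' le_rfl (ENNReal.rpow_le_rpow (lintegral_mono fun x => ?_) hq.le)
      exact monotone_trunc volume _ x hij
  rw [hsup, rpow_iSup_eq _ (by positivity), ENNReal.mul_iSup]
  refine iSup_le fun k => ?_
  refine (hC.dualNorm_mul_le hp₁ hp₁' hq hq' hv₁ (aemeasurable_trunc volume hw k) t).trans ?_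
  rw [wNorm_top]
  calc (C : ℝ≥0∞) * _ ≤ C * 1 := by
        gcongr
        refine essSup_le_of_ae_le 1 (Filter.Eventually.of_forall fun x => ?_)
        calc trunc volume (fun x => (v₂ x : ℝ≥0∞)⁻¹) k x * v₂ x ≤ (v₂ x : ℝ≥0∞)⁻¹ * v₂ x :=
              mul_le_mul' (trunc_le volume (fun x => (v₂ x : ℝ≥0∞)⁻¹) k x) le_rfl
          _ ≤ 1 := ENNReal.inv_mul_le_one _
    _ = C := mul_one _

end

/-! ### The lower bound for `q < p₂ < ∞` -/

section

variable {n : ℕ} {p₁ p₂ q : ℝ≥0∞} {u : ℝ → ℝ≥0} {v₁ v₂ : EuclideanSpace ℝ (Fin n) → ℝ≥0}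

/-- The lower bound of `C` for `q < p₂ < ∞`, with the integrable density `h ≤ v₂ ^ (1 - p₂')` in
place of `v₂ ^ (1 - p₂')`. With `U(s) = ∫_0^s u` and `S(s) = ∫_{ℝⁿ ∖ B(0,s)} h`, the test function is
`g(x) = U(|x|) ^ (r / (p₂ q)) S(|x|) ^ (r (q - 1) / (p₂ q)) h(x)`. -/
theorem HardyIneq.dualNorm_mul_lintegral_tail_le {C : ℝ≥0} (hC : HardyIneq p₁ p₂ q u v₁ v₂ C)
    (hp₁ : 1 ≤ p₁) (hp₁' : p₁ ≠ ∞) (hp₂ : 1 < p₂) (hp₂' : p₂ ≠ ∞) (hq : 1 ≤ q.toReal)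
    (hq' : q ≠ ∞) {r : ℝ} (hr : 0 < r) (hpqr : 1 / r = 1 / q.toReal - 1 / p₂.toReal)
    (hu : AEMeasurable (fun t => (u t : ℝ≥0∞)) (volume.restrict (Ioi 0)))
    (hv₁ : AEMeasurable fun x => (v₁ x : ℝ≥0∞)) {t : ℝ} (hU : primitive u t ≠ ∞)
    {h : EuclideanSpace ℝ (Fin n) → ℝ≥0∞} (hh : AEMeasurable h) (hint : ∫⁻ x, h x ≠ ∞)
    (hle : ∀ x, h x ≤ dualDensity p₂ v₂ x) :
    dualNorm p₁ v₁ t *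
        (∫⁻ y in Ioo 0 t, primitive u y ^ (r / p₂.toReal) * u y *
          (∫⁻ x in coBall n y, h x) ^ (r / p₂.conjExponent.toReal)) ^ (1 / r) ≤
      2 ^ (r / p₂.conjExponent.toReal / q.toReal) * 2 ^ (r / q.toReal / p₂.toReal) * C := by
  have hc := holderConjugate_toReal hp₂ hp₂'
  set P := p₂.toReal
  set P' := p₂.conjExponent.toReal
  set Q := q.toReal
  have hQ0 : 0 < Q := by linarith
  have hP0 : 0 < P := hc.pos
  have hP'0 : 0 < P' := hc.symm.pos
  -- relations between the exponents
  have ea : r / Q = r / P + 1 := by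
    have : r * (1 / r) = r * (1 / Q - 1 / P) := by rw [hpqr]
    rw [mul_one_div_cancel hr.ne'] at this
    rw [this]; ring
  have eP' : r / P' = r - r / P := by
    have := hc.inv_add_inv_eq_one
    have h2 : P'⁻¹ = 1 - P⁻¹ := by linarith
    rw [div_eq_mul_inv, h2]; ring
  have eb : r * (Q - 1) / Q + 1 = r / P' := by
    rw [eP']
    have : r * (Q - 1) / Q = r - r / Q := by field_simp
    rw [this, ea]; ring
  have hb0 : 0 ≤ r * (Q - 1) / Q := by
    have : 0 ≤ Q - 1 := by linarith
    positivity
  have hβ0 : 0 ≤ r * (Q - 1) / (P * Q) := by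
    have : 0 ≤ Q - 1 := by linarith
    positivity
  have eβ : (r * (Q - 1) / (P * Q) + 1) * Q = r / P' := by
    have h1 : (r * (Q - 1) / (P * Q) + 1) * Q = r / P * (Q - 1) + Q := by field_simp
    have h2 : r / P = r / Q - 1 := by linarith
    rw [h1, ← eb, h2]
    field_simp
    ring
  set μ := densityOn (Ioo 0 t) fun s => (u s : ℝ≥0∞)
  have huIoo : AEMeasurable (fun s => (u s : ℝ≥0∞)) (volume.restrict (Ioo 0 t)) :=
    hu.mono_set Ioo_subset_Ioi_self
  have hμuniv : μ univ = primitive u t := densityOn_univ _ _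
  have : IsFiniteMeasure μ := ⟨by rw [hμuniv]; exact hU.lt_top⟩
  set ν : Measure (EuclideanSpace ℝ (Fin n)) := volume.withDensity h with hν
  have : IsFiniteMeasure ν := ⟨by
    rw [hν, withDensity_apply _ MeasurableSet.univ, Measure.restrict_univ]; exact hint.lt_top⟩
  set S := tail ν norm
  have hSeq : ∀ s, S s = ∫⁻ x in coBall n s, h x := tail_withDensity h
  have hUeq : ∀ s ∈ Ioo 0 t, μ (Iic s) = primitive u s := fun s hs =>
    densityOn_Iic _ (Iic_inter_Ioo_zero hs.2)
  have hSm : Measurable S := measurable_tail ν norm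
  have hUm := measurable_measure_Iic μ
  set A := ∫⁻ s, μ (Iic s) ^ (r / P) * S s ^ (r / P') ∂μ with hA
  have hAeq : ∫⁻ y in Ioo 0 t, primitive u y ^ (r / P) * u y *
          (∫⁻ x in coBall n y, h x) ^ (r / P') = A := by
    rw [hA]
    have hm : Measurable fun s => μ (Iic s) ^ (r / P) * S s ^ (r / P') :=
      (hUm.pow_const _).mul (hSm.pow_const _)
    rw [lintegral_densityOn huIoo hm]
    refine setLIntegral_congr_fun measurableSet_Ioo fun s hs => ?_
    simp only [hUeq s hs, hSeq]
    ring
  have hAfin : A ≠ ∞ := by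
    refine ne_top_of_le_ne_top (b := ∫⁻ _, μ univ ^ (r / P) * ν univ ^ (r / P') ∂μ) ?_ ?_
    · rw [lintegral_const]
      exact ENNReal.mul_ne_top (ENNReal.mul_ne_top
        (ENNReal.rpow_ne_top_of_nonneg (by positivity) (measure_ne_top _ _))
        (ENNReal.rpow_ne_top_of_nonneg (by positivity) (measure_ne_top _ _))) (measure_ne_top _ _)
    · refine lintegral_mono fun s => mul_le_mul' (ENNReal.rpow_le_rpow ?_ (by positivity))
        (ENNReal.rpow_le_rpow ?_ (by positivity))
      · exact measure_mono (subset_univ _)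
      · exact measure_mono (subset_univ _)
  rw [hAeq]
  rcases eq_or_ne A 0 with hA0 | hA0
  · rw [hA0, ENNReal.zero_rpow_of_pos (by positivity), mul_zero]
    exact zero_le
  set k : EuclideanSpace ℝ (Fin n) → ℝ≥0∞ := fun x =>
    μ (Iic ‖x‖) ^ (r / (P * Q)) * S ‖x‖ ^ (r * (Q - 1) / (P * Q)) with hk
  have hkm : Measurable k :=
    ((hUm.comp measurable_norm).pow_const _).mul ((hSm.comp measurable_norm).pow_const _)
  set g : EuclideanSpace ℝ (Fin n) → ℝ≥0∞ := fun x => h x * k x with hg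
  have hgm : AEMeasurable g := hh.mul hkm.aemeasurable
  have hnorm : wNorm p₂ (fun x => (v₂ x : ℝ≥0∞)) univ g ≤ (2 ^ (r / Q) * A) ^ (1 / P) := by
    rw [wNorm_of_ne_top hp₂', Measure.restrict_univ]
    refine ENNReal.rpow_le_rpow ?_ (by positivity)
    have hkP : ∀ x, k x ^ P = μ (Iic ‖x‖) ^ (r / P + 1) * S ‖x‖ ^ (r * (Q - 1) / Q) := fun x => by
      rw [hk, ENNReal.mul_rpow_of_nonneg _ _ hP0.le, ← ENNReal.rpow_mul, ← ENNReal.rpow_mul, ← ea]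
      congr 2 <;> field_simp
    calc ∫⁻ x, g x ^ P * v₂ x ≤ ∫⁻ x, h x * k x ^ P := by
          refine lintegral_mono fun x => ?_
          calc g x ^ P * v₂ x = h x ^ P * v₂ x * k x ^ P := by
                rw [hg, ENNReal.mul_rpow_of_nonneg _ _ hP0.le]; ring
            _ ≤ h x * k x ^ P :=
                mul_le_mul' (rpow_mul_le_of_le_dualDensity hp₂ hp₂' (hle x)) le_rfl
      _ = ∫⁻ x, k x ^ P ∂ν := by
          rw [hν, lintegral_withDensity_eq_lintegral_mul₀ hh (hkm.pow_const P).aemeasurable]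
          rfl
      _ ≤ 2 ^ (r / P + 1) * ∫⁻ s, μ (Iic s) ^ (r / P) * S s ^ (r * (Q - 1) / Q + 1) ∂μ := by
          simp_rw [hkP]
          exact lintegral_rpow_mul_rpow_tail_le μ ν measurable_norm (by positivity) hb0
      _ = 2 ^ (r / Q) * A := by rw [eb, ← ea]
  have hlow : A ^ (1 / Q) ≤ 2 ^ (r / P' / Q) *
      (∫⁻ s in Ioo 0 t, u s * (∫⁻ x in coBall n s, g x) ^ Q) ^ (1 / Q) := by
    have hGk : ∀ s, ∫⁻ x in coBall n s, g x = ∫⁻ x in {x | s ≤ ‖x‖}, k x ∂ν := fun s => by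
      rw [← coBall_eq, hν, restrict_withDensity (measurableSet_coBall n s),
        lintegral_withDensity_eq_lintegral_mul₀ hh.restrict hkm.aemeasurable]
      rfl
    have hpt : ∀ s, μ (Iic s) ^ (r / P) * S s ^ (r / P') ≤
        2 ^ (r / P') * (∫⁻ x in coBall n s, g x) ^ Q := fun s => by
      have h1 := rpow_mul_rpow_tail_le_lintegral μ ν measurable_norm
        (show 0 ≤ r / (P * Q) by positivity) hβ0 s
      have h2 := ENNReal.rpow_le_rpow h1 hQ0.le
      rw [ENNReal.mul_rpow_of_nonneg _ _ hQ0.le, ENNReal.mul_rpow_of_nonneg _ _ hQ0.le,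
        ← ENNReal.rpow_mul, ← ENNReal.rpow_mul, ← ENNReal.rpow_mul, eβ,
        show r / (P * Q) * Q = r / P by field_simp] at h2
      rw [hGk]
      exact h2
    have hAle : A ≤ 2 ^ (r / P') * ∫⁻ s in Ioo 0 t, u s * (∫⁻ x in coBall n s, g x) ^ Q := by
      have hGm : Measurable fun s => (∫⁻ x in coBall n s, g x) ^ Q :=
        (measurable_setLIntegral_coBall g).pow_const _
      calc A ≤ ∫⁻ s, 2 ^ (r / P') * (∫⁻ x in coBall n s, g x) ^ Q ∂μ := lintegral_mono hpt
        _ = 2 ^ (r / P') * ∫⁻ s, (∫⁻ x in coBall n s, g x) ^ Q ∂μ := lintegral_const_mul _ hGm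
        _ = _ := by rw [lintegral_densityOn huIoo hGm]
    refine (ENNReal.rpow_le_rpow hAle (show 0 ≤ 1 / Q by positivity)).trans_eq ?_
    rw [ENNReal.mul_rpow_of_nonneg _ _ (by positivity), ← ENNReal.rpow_mul, mul_one_div]
  have hmain : dualNorm p₁ v₁ t * A ^ (1 / Q) ≤
      2 ^ (r / P' / Q) * 2 ^ (r / Q / P) * C * A ^ (1 / P) := by
    calc dualNorm p₁ v₁ t * A ^ (1 / Q)
        ≤ dualNorm p₁ v₁ t * (2 ^ (r / P' / Q) *
          (∫⁻ s in Ioo 0 t, u s * (∫⁻ x in coBall n s, g x) ^ Q) ^ (1 / Q)) :=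
          mul_le_mul' le_rfl hlow
      _ = 2 ^ (r / P' / Q) * (dualNorm p₁ v₁ t *
          (∫⁻ s in Ioo 0 t, u s * (∫⁻ x in coBall n s, g x) ^ Q) ^ (1 / Q)) := by ring
      _ ≤ 2 ^ (r / P' / Q) * (C * (2 ^ (r / Q) * A) ^ (1 / P)) := by
          refine mul_le_mul' le_rfl
            ((hC.dualNorm_mul_le hp₁ hp₁' hQ0 hq' hv₁ hgm t).trans (mul_le_mul' le_rfl hnorm))
      _ = _ := by
          rw [ENNReal.mul_rpow_of_nonneg _ _ (by positivity), ← ENNReal.rpow_mul, mul_one_div]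
          ring
  -- division by the finite positive number `A ^ (1 / P)`
  have hAP0 : A ^ (1 / P) ≠ 0 := (ENNReal.rpow_pos (pos_iff_ne_zero.2 hA0) hAfin).ne'
  have hAPt : A ^ (1 / P) ≠ ∞ := ENNReal.rpow_ne_top_of_nonneg (by positivity) hAfin
  rw [← ENNReal.mul_le_mul_iff_left hAP0 hAPt, mul_assoc, ← ENNReal.rpow_add _ _ hA0 hAfin,
    show 1 / r + 1 / P = 1 / Q by rw [hpqr]; ring]
  exact hmain

/-- Necessity for `q < p₂ < ∞`, by exhausting `v₂ ^ (1 - p₂')` with truncations. -/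
theorem HardyIneq.dualNorm_mul_lintegral_dualNorm_le {C : ℝ≥0} (hC : HardyIneq p₁ p₂ q u v₁ v₂ C)
    (hn : 1 ≤ n)
    (hp₁ : 1 ≤ p₁) (hp₁' : p₁ ≠ ∞) (hp₂ : 1 < p₂) (hp₂' : p₂ ≠ ∞) (hq : 1 ≤ q.toReal)
    (hq' : q ≠ ∞) {r : ℝ} (hr : 0 < r) (hpqr : 1 / r = 1 / q.toReal - 1 / p₂.toReal)
    (hu : AEMeasurable (fun t => (u t : ℝ≥0∞)) (volume.restrict (Ioi 0)))
    (hv₁ : AEMeasurable fun x => (v₁ x : ℝ≥0∞)) (hv₂ : AEMeasurable fun x => (v₂ x : ℝ≥0∞)) (t : ℝ) :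
    dualNorm p₁ v₁ t *
        (∫⁻ y in Ioo 0 t, primitive u y ^ (r / p₂.toReal) * u y * dualNorm p₂ v₂ y ^ r) ^ (1 / r) ≤
      2 ^ (r / p₂.conjExponent.toReal / q.toReal) * 2 ^ (r / q.toReal / p₂.toReal) * C := by
  have hc := holderConjugate_toReal hp₂ hp₂'
  have hP'0 := hc.symm.pos
  have hq0 : 0 < q.toReal := by linarith
  -- `U(t)` is finite, because the inequality bounds `U(t) ^ (1 / q)` times two positive factors
  have hU : primitive u t ≠ ∞ := by
    intro hU
    have h := hC.primitive_mul_dualNorm_le hp₁ hp₁' hp₂.le hp₂' hq0 hq' hv₁ hv₂ t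
    rw [hU, ENNReal.top_rpow_of_pos (by positivity),
      ENNReal.top_mul (dualNorm_ne_zero hn hp₁ hp₁' hv₁ t),
      ENNReal.top_mul (dualNorm_ne_zero hn hp₂.le hp₂' hv₂ t)] at h
    exact ENNReal.coe_ne_top (top_le_iff.1 h)
  have hσ := aemeasurable_dualDensity (p := p₂) hv₂
  have hUm : Measurable fun y => primitive u y ^ (r / p₂.toReal) :=
    (monotone_primitive u).measurable.pow_const _
  have hsup : ∫⁻ y in Ioo 0 t, primitive u y ^ (r / p₂.toReal) * u y * dualNorm p₂ v₂ y ^ r =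
      ⨆ k, ∫⁻ y in Ioo 0 t, primitive u y ^ (r / p₂.toReal) * u y *
        (∫⁻ x in coBall n y, trunc volume (dualDensity p₂ v₂) k x) ^
          (r / p₂.conjExponent.toReal) := by
    rw [← lintegral_iSup']
    · refine lintegral_congr fun y => ?_
      rw [dualNorm_eq hp₂, ← ENNReal.rpow_mul, one_div_mul_eq_div,
        ← iSup_setLIntegral_trunc volume hσ, rpow_iSup_eq _ (by positivity), ENNReal.mul_iSup]
    · exact fun k => (hUm.aemeasurable.mul (hu.mono_set Ioo_subset_Ioi_self)).mul
        ((measurable_setLIntegral_coBall _).pow_const _).aemeasurable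
    · refine Filter.Eventually.of_forall fun y i j hij => ?_
      refine mul_le_mul' le_rfl (ENNReal.rpow_le_rpow (lintegral_mono fun x => ?_) (by positivity))
      exact monotone_trunc volume _ x hij
  rw [hsup, rpow_iSup_eq _ (by positivity), ENNReal.mul_iSup]
  exact iSup_le fun k => hC.dualNorm_mul_lintegral_tail_le hp₁ hp₁' hp₂ hp₂' hq hq' hr hpqr hu hv₁
    hU (aemeasurable_trunc volume hσ k) (lintegral_trunc_ne_top volume _ k)
    (trunc_le volume _ k)

end

/-! ### Upper bounds of the constant -/

section

variable {n : ℕ} {p₁ p₂ q : ℝ≥0∞} {u : ℝ → ℝ≥0} {v₁ v₂ : EuclideanSpace ℝ (Fin n) → ℝ≥0}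

theorem rpow_two_mul_rpow_le {P Q : ℝ} (hP : 1 ≤ P) (hQ : 0 < Q) (x : ℝ≥0∞) :
    ((2 * x) ^ (Q / P)) ^ (1 / Q) ≤ 2 * x ^ (1 / P) := by
  have hP0 : 0 < P := by linarith
  rw [← ENNReal.rpow_mul, show Q / P * (1 / Q) = 1 / P by field_simp,
    ENNReal.mul_rpow_of_nonneg _ _ (by positivity)]
  gcongr
  calc (2 : ℝ≥0∞) ^ (1 / P) ≤ 2 ^ (1 : ℝ) :=
        ENNReal.rpow_le_rpow_of_exponent_le (by norm_num) ((div_le_one hP0).2 hP)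
    _ = 2 := ENNReal.rpow_one 2

/-- Passage from the linear inequalities to the bilinear one. The hypothesis `hG` is an inequality
for `g` alone with the weight `u` on `(0,t)`; it provides exactly the condition under which the
Hardy inequality for `p₁ ≤ q` holds for `f` with the weight `u (∫_{ℝⁿ ∖ B(0,·)} g) ^ q`. The
hypothesis `h0` takes care of the products `0 · ∞`. -/
theorem hardyIneq_of_lintegral_le {K B : ℝ≥0} (hK : K ≠ 0) (hn : 1 ≤ n)
    (hp₁ : 1 ≤ p₁) (hp₁' : p₁ ≠ ∞) (hpq : p₁.toReal ≤ q.toReal) (hq' : q ≠ ∞)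
    (hu : AEMeasurable (fun t => (u t : ℝ≥0∞)) (volume.restrict (Ioi 0)))
    (hv₁ : AEMeasurable fun x => (v₁ x : ℝ≥0∞))
    (h0 : ∀ t, 0 < t → primitive u t ≠ 0 → dualNorm p₁ v₁ t ≠ ∞ ∧ B ≠ 0)
    (hG : ∀ g : EuclideanSpace ℝ (Fin n) → ℝ≥0∞, AEMeasurable g →
      wNorm p₂ (fun x => (v₂ x : ℝ≥0∞)) univ g ≠ ∞ → ∀ t, 0 < t → dualNorm p₁ v₁ t *
        (∫⁻ s in Ioo 0 t, u s * (∫⁻ x in coBall n s, g x) ^ q.toReal) ^ (1 / q.toReal) ≤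
      K * B * wNorm p₂ (fun x => (v₂ x : ℝ≥0∞)) univ g) :
    HardyIneq p₁ p₂ q u v₁ v₂ (8 * (K * B)) := by
  intro f g hf hg
  set P := p₁.toReal with hP
  set Q := q.toReal with hQ
  have hP1 : 1 ≤ P := by
    rw [hP, ← ENNReal.toReal_one]
    exact ENNReal.toReal_mono hp₁' hp₁
  have hP0 : 0 < P := by linarith
  have hQ0 : 0 < Q := by linarith
  set Xf := wNorm p₁ (fun x => (v₁ x : ℝ≥0∞)) univ f with hX
  set Y := wNorm p₂ (fun x => (v₂ x : ℝ≥0∞)) univ g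
  set F : ℝ → ℝ≥0∞ := fun t => ∫⁻ x in coBall n t, f x
  set G : ℝ → ℝ≥0∞ := fun t => ∫⁻ x in coBall n t, g x
  set ν : Measure (EuclideanSpace ℝ (Fin n)) := volume.withDensity f
  set κ : Measure (EuclideanSpace ℝ (Fin n)) := volume.withDensity fun x => f x ^ P * v₁ x with hκ
  have hH : HolderBound P (dualNorm p₁ v₁) ν κ norm := holderBound_dualNorm hp₁ hp₁' hv₁ hf
  have hκu : κ univ ^ (1 / P) = Xf := by
    rw [hX, wNorm_of_ne_top hp₁', hκ, withDensity_apply _ MeasurableSet.univ]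
  have hFt : ∀ t, tail ν norm t = F t := tail_withDensity f
  set μ := densityOn (Ioi 0) fun s => (u s : ℝ≥0∞) with hμ
  have hFm : Measurable F := measurable_setLIntegral_coBall f
  have hGm : Measurable G := measurable_setLIntegral_coBall g
  have hFGm : Measurable fun t => (F t * G t) ^ Q := (hFm.mul hGm).pow_const Q
  have huG : AEMeasurable (fun s => u s * G s ^ Q) (volume.restrict (Ioi 0)) :=
    hu.mul (hGm.pow_const Q).aemeasurable
  have hlhs : wNorm q (fun t => (u t : ℝ≥0∞)) (Ioi (0 : ℝ)) (fun t => F t * G t) =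
      (∫⁻ t, (F t * G t) ^ Q ∂μ) ^ (1 / Q) := by
    rw [wNorm_of_ne_top hq', lintegral_densityOn hu hFGm]
    simp only [mul_comm, hQ]
  rw [hlhs]
  have hae : ∀ᵐ s ∂μ, dualNorm p₁ v₁ s ≠ ∞ ∧ B ≠ 0 :=
    (ae_densityOn_Ioi_primitive_ne_zero u).mono fun s hs => h0 s hs.1 hs.2
  have hzero : (∀ᵐ s ∂μ, F s * G s = 0) → (∫⁻ t, (F t * G t) ^ Q ∂μ) ^ (1 / Q) = 0 := by
    intro h
    rw [ENNReal.rpow_eq_zero_iff_of_pos (by positivity), lintegral_eq_zero_iff hFGm]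
    exact h.mono fun s hs => by simp [hs, hQ0]
  rcases eq_or_ne B 0 with hB0 | hB0
  · rw [hzero (hae.mono fun s hs => absurd hB0 hs.2)]
    exact zero_le
  have hC0 : ((8 * (K * B) : ℝ≥0) : ℝ≥0∞) ≠ 0 := by
    simp [hK, hB0]
  rcases eq_or_ne Xf 0 with hX0 | hX0
  · rw [hzero (hae.mono fun s hs => ?_)]
    · exact zero_le
    · have := hH.tail_le hP0 measurable_norm hs.1
      rw [hκu, hX0, mul_zero, hFt] at this
      rw [nonpos_iff_eq_zero.1 this, zero_mul]
  rcases eq_or_ne Y ∞ with hYt | hYt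
  · rw [hYt, ENNReal.mul_top (mul_ne_zero hC0 hX0)]
    exact le_top
  have hW : ∀ t, 0 < t → dualNorm p₁ v₁ t * (∫⁻ s in Ioo 0 t, u s * G s ^ Q) ^ (1 / Q) ≤
      K * B * Y := fun t ht => hG g hg hYt t ht
  set μG := densityOn (Ioi 0) fun s => u s * G s ^ Q with hμG
  have hint : ∫⁻ t, (F t * G t) ^ Q ∂μ = ∫⁻ t, F t ^ Q ∂μG := by
    rw [lintegral_densityOn hu hFGm,
      lintegral_densityOn huG (hFm.pow_const Q)]
    refine lintegral_congr fun s => ?_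
    rw [ENNReal.mul_rpow_of_nonneg _ _ hQ0.le]
    ring
  have hac : μG ≪ μ := by
    have : μG = μ.withDensity fun s => G s ^ Q := by
      rw [hμ, hμG, densityOn, densityOn]
      exact withDensity_mul₀ hu (hGm.pow_const Q).aemeasurable
    rw [this]
    exact withDensity_absolutelyContinuous _ _
  have hB : ∀ᵐ s ∂μG, μG (Iic s) * dualNorm p₁ v₁ s ^ Q ≤ (K * B * Y) ^ Q := by
    filter_upwards [ae_densityOn_mem measurableSet_Ioi _] with s hs
    rw [hμG, densityOn_Iic _ (Iic_inter_Ioi_zero s)]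
    have := ENNReal.rpow_le_rpow (hW s hs) hQ0.le
    rwa [ENNReal.mul_rpow_of_nonneg _ _ hQ0.le, ← ENNReal.rpow_mul, one_div_mul_cancel hQ0.ne',
      ENNReal.rpow_one, mul_comm] at this
  rw [hint]
  rcases eq_or_ne Xf ∞ with hXt | hXt
  · rcases eq_or_ne Y 0 with hY0 | hY0
    · -- here `μG` vanishes, as its mass on each `Iic s` does
      have : μG = 0 := by
        have h1 : ∀ᵐ s ∂μG, False := by
          filter_upwards [hB, ae_measure_Iic_ne_zero μG] with s h1 h2
          rw [hY0, mul_zero, ENNReal.zero_rpow_of_pos hQ0, nonpos_iff_eq_zero, mul_eq_zero] at h1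
          rcases h1 with h1 | h1
          · exact h2 h1
          · rw [ENNReal.rpow_eq_zero_iff_of_pos hQ0] at h1
            exact dualNorm_ne_zero hn hp₁ hp₁' hv₁ s h1
        rw [← ae_eq_bot]
        exact Filter.eventually_false_iff_eq_bot.1 h1
      rw [this, lintegral_zero_measure, ENNReal.zero_rpow_of_pos (by positivity)]
      exact zero_le
    · rw [hXt, ENNReal.mul_top hC0, ENNReal.top_mul hY0]
      exact le_top
  have hκfin : κ univ ≠ ∞ := fun h => hXt (by
    rw [← hκu, h, ENNReal.top_rpow_of_pos (by positivity)])
  have hmain := hH.lintegral_rpow_tail_le hP0 hpq measurable_norm hκfin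
    (hac.ae_le (hae.mono fun s hs => hs.1)) hB
  simp_rw [hFt] at hmain
  calc (∫⁻ t, F t ^ Q ∂μG) ^ (1 / Q)
      ≤ ((4 * (K * B * Y)) ^ Q * (2 * κ univ) ^ (Q / P)) ^ (1 / Q) := by gcongr
    _ = 4 * (K * B * Y) * ((2 * κ univ) ^ (Q / P)) ^ (1 / Q) := by
        rw [ENNReal.mul_rpow_of_nonneg _ _ (by positivity), ← ENNReal.rpow_mul,
          mul_one_div_cancel hQ0.ne', ENNReal.rpow_one]
    _ ≤ 4 * (K * B * Y) * (2 * κ univ ^ (1 / P)) := by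
        gcongr
        exact rpow_two_mul_rpow_le hP1 hQ0 _
    _ = _ := by
        rw [hκu]
        push_cast
        ring

/-- Sufficiency for `p₂ ≤ q`: for fixed `t` the linear Hardy inequality for `g` has the constant
`sup_{s < t} U(s) ^ (1/q) D₂(s) ≤ B / D₁(t)`, as `D₁` is antitone. -/
theorem hardyIneq_of_B₁_eq (hn : 1 ≤ n) (hp₁ : 1 ≤ p₁) (hp₁' : p₁ ≠ ∞) (hp₂ : 1 ≤ p₂)
    (hp₁q : p₁.toReal ≤ q.toReal) (hp₂q : p₂.toReal ≤ q.toReal) (hp₂' : p₂ ≠ ∞) (hq' : q ≠ ∞)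
    (hu : AEMeasurable (fun t => (u t : ℝ≥0∞)) (volume.restrict (Ioi 0)))
    (hv₁ : AEMeasurable fun x => (v₁ x : ℝ≥0∞)) (hv₂ : AEMeasurable fun x => (v₂ x : ℝ≥0∞))
    {B : ℝ≥0} (hB : B₁ p₁ p₂ q u v₁ v₂ = B) : HardyIneq p₁ p₂ q u v₁ v₂ (8 * (8 * B)) := by
  set P := p₂.toReal with hP
  set Q := q.toReal
  have hP1 : 1 ≤ P := by
    rw [hP, ← ENNReal.toReal_one]
    exact ENNReal.toReal_mono hp₂' hp₂
  have hP0 : 0 < P := by linarith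
  have hQ0 : 0 < Q := by linarith
  have hle : ∀ t, 0 < t → primitive u t ^ (1 / Q) * dualNorm p₁ v₁ t * dualNorm p₂ v₂ t ≤ B :=
    fun t ht => hB ▸ le_iSup₂ (f := fun (t : ℝ) (_ : t ∈ Ioi (0 : ℝ)) =>
      primitive u t ^ (1 / Q) * dualNorm p₁ v₁ t * dualNorm p₂ v₂ t) t ht
  have hD1 := dualNorm_ne_zero hn hp₁ hp₁' hv₁
  have hD2 := dualNorm_ne_zero hn hp₂ hp₂' hv₂
  have hU0 : ∀ t, primitive u t ≠ 0 → primitive u t ^ (1 / Q) ≠ 0 := fun t ht h =>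
    ht ((ENNReal.rpow_eq_zero_iff_of_pos (by positivity)).1 h)
  have h0 : ∀ t, 0 < t → primitive u t ≠ 0 →
      dualNorm p₁ v₁ t ≠ ∞ ∧ dualNorm p₂ v₂ t ≠ ∞ ∧ B ≠ 0 := by
    intro t ht hUt
    have h := hle t ht
    refine ⟨fun h1 => ?_, fun h1 => ?_, fun h1 => ?_⟩
    · rw [h1, ENNReal.mul_top (hU0 t hUt), ENNReal.top_mul (hD2 t)] at h
      exact ENNReal.coe_ne_top (top_le_iff.1 h)
    · rw [h1, ENNReal.mul_top (mul_ne_zero (hU0 t hUt) (hD1 t))] at h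
      exact ENNReal.coe_ne_top (top_le_iff.1 h)
    · rw [h1, ENNReal.coe_zero, nonpos_iff_eq_zero] at h
      exact mul_ne_zero (mul_ne_zero (hU0 t hUt) (hD1 t)) (hD2 t) h
  refine hardyIneq_of_lintegral_le (by norm_num) hn hp₁ hp₁' hp₁q hq' hu hv₁
    (fun t ht hUt => ⟨(h0 t ht hUt).1, (h0 t ht hUt).2.2⟩) fun g hg hY t ht => ?_
  rcases eq_or_ne (primitive u t) 0 with hUt | hUt
  · have : ∫⁻ s in Ioo 0 t, u s * (∫⁻ x in coBall n s, g x) ^ Q = 0 := by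
      have hu0 : (fun s => (u s : ℝ≥0∞)) =ᵐ[volume.restrict (Ioo 0 t)] 0 :=
        (lintegral_eq_zero_iff' (hu.mono_set Ioo_subset_Ioi_self)).1 hUt
      rw [lintegral_congr_ae (g := fun _ => 0) (hu0.mono fun s hs => by
        simp only [Pi.zero_apply] at hs; simp only [hs, zero_mul])]
      simp
    rw [this, ENNReal.zero_rpow_of_pos (by positivity), mul_zero]
    exact zero_le
  have hD1t := (h0 t ht hUt).1
  set μ := densityOn (Ioo 0 t) fun s => (u s : ℝ≥0∞) with hμ
  set κ : Measure (EuclideanSpace ℝ (Fin n)) := volume.withDensity fun x => g x ^ P * v₂ x with hκ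
  have hκu : κ univ ^ (1 / P) = wNorm p₂ (fun x => (v₂ x : ℝ≥0∞)) univ g := by
    rw [wNorm_of_ne_top hp₂', hκ, withDensity_apply _ MeasurableSet.univ]
  have hκfin : κ univ ≠ ∞ := fun h => hY (by
    rw [← hκu, h, ENNReal.top_rpow_of_pos (by positivity)])
  have hae := ae_densityOn_Ioo_primitive_ne_zero u t
  have hmain := (holderBound_dualNorm hp₂ hp₂' hv₂ hg).lintegral_rpow_tail_le hP0 hp₂q
    measurable_norm hκfin (μ := μ) (hae.mono fun s hs => (h0 s hs.1.1 hs.2).2.1)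
    (B := B / dualNorm p₁ v₁ t) (by
      filter_upwards [ae_densityOn_mem measurableSet_Ioo _] with s hs
      rw [hμ, densityOn_Iic _ (Iic_inter_Ioo_zero hs.2)]
      have h1 : primitive u s ^ (1 / Q) * dualNorm p₂ v₂ s ≤ B / dualNorm p₁ v₁ t := by
        rw [ENNReal.le_div_iff_mul_le (Or.inl (hD1 t)) (Or.inl hD1t)]
        calc primitive u s ^ (1 / Q) * dualNorm p₂ v₂ s * dualNorm p₁ v₁ t
            ≤ primitive u s ^ (1 / Q) * dualNorm p₂ v₂ s * dualNorm p₁ v₁ s := by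
              gcongr
              exact antitone_dualNorm hp₁ hs.2.le
          _ = primitive u s ^ (1 / Q) * dualNorm p₁ v₁ s * dualNorm p₂ v₂ s := by ring
          _ ≤ B := hle s hs.1
      have h2 := ENNReal.rpow_le_rpow h1 hQ0.le
      rwa [ENNReal.mul_rpow_of_nonneg _ _ hQ0.le, ← ENNReal.rpow_mul, one_div_mul_cancel hQ0.ne',
        ENNReal.rpow_one] at h2)
  simp_rw [tail_withDensity] at hmain
  have hGm : Measurable fun s => (∫⁻ x in coBall n s, g x) ^ Q :=
    (measurable_setLIntegral_coBall g).pow_const _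
  rw [lintegral_densityOn (hu.mono_set Ioo_subset_Ioi_self) hGm] at hmain
  calc dualNorm p₁ v₁ t *
        (∫⁻ s in Ioo 0 t, u s * (∫⁻ x in coBall n s, g x) ^ Q) ^ (1 / Q)
      ≤ dualNorm p₁ v₁ t *
        ((4 * (B / dualNorm p₁ v₁ t)) ^ Q * (2 * κ univ) ^ (Q / P)) ^ (1 / Q) := by
        gcongr
    _ = dualNorm p₁ v₁ t *
        (4 * (B / dualNorm p₁ v₁ t) * ((2 * κ univ) ^ (Q / P)) ^ (1 / Q)) := by
        rw [ENNReal.mul_rpow_of_nonneg _ _ (by positivity), ← ENNReal.rpow_mul,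
          mul_one_div_cancel hQ0.ne', ENNReal.rpow_one]
    _ ≤ dualNorm p₁ v₁ t * (4 * (B / dualNorm p₁ v₁ t) * (2 * κ univ ^ (1 / P))) := by
        gcongr
        exact rpow_two_mul_rpow_le hP1 hQ0 _
    _ = dualNorm p₁ v₁ t * (B / dualNorm p₁ v₁ t) * (8 * κ univ ^ (1 / P)) := by ring
    _ ≤ B * (8 * κ univ ^ (1 / P)) := by
        gcongr
        exact ENNReal.mul_div_le
    _ = _ := by rw [hκu]; push_cast; ring

/-- Since `U > 0` almost everywhere with respect to `u dt`, it suffices that `w` is positive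
where `U` is. -/
theorem lintegral_mul_ne_zero {t : ℝ} {w : ℝ → ℝ≥0∞}
    (hu : AEMeasurable (fun t => (u t : ℝ≥0∞)) (volume.restrict (Ioi 0)))
    (hw : Measurable w) (hw0 : ∀ s, primitive u s ≠ 0 → w s ≠ 0) (hUt : primitive u t ≠ 0) :
    ∫⁻ y in Ioo 0 t, u y * w y ≠ 0 := by
  have h1 : ∫⁻ y in Ioo 0 t, u y * w y =
      ∫⁻ y, w y ∂densityOn (Ioo 0 t) fun s => (u s : ℝ≥0∞) := by
    rw [lintegral_densityOn (hu.mono_set Ioo_subset_Ioi_self) hw]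
  rw [h1, Ne, lintegral_eq_zero_iff hw]
  intro h
  have h2 : ∀ᵐ s ∂densityOn (Ioo 0 t) fun s => (u s : ℝ≥0∞), False := by
    filter_upwards [h, ae_densityOn_Ioo_primitive_ne_zero u t] with s hs hs'
    exact hw0 s hs'.2 hs
  have h3 : densityOn (Ioo 0 t) (fun s => (u s : ℝ≥0∞)) = 0 := by
    rw [← ae_eq_bot]
    exact Filter.eventually_false_iff_eq_bot.1 h2
  refine hUt ?_
  have h4 : densityOn (Ioo 0 t) (fun s => (u s : ℝ≥0∞)) univ = primitive u t :=
    densityOn_univ _ _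
  rw [← h4, h3]
  simp

/-- The common part of the upper bounds for `q < p₂`: there the condition on the weights has the
form `‖v₁ ^ (-1/p₁)‖ (∫_0^t u w) ^ (1/s) ≤ B`. -/
theorem hardyIneq_of_dualNorm_mul_le {K B : ℝ≥0} {s : ℝ} (hs : 0 < s) {w : ℝ → ℝ≥0∞}
    (hw : Measurable w) (hw0 : ∀ s, primitive u s ≠ 0 → w s ≠ 0) (hK : K ≠ 0) (hn : 1 ≤ n)
    (hp₁ : 1 ≤ p₁) (hp₁' : p₁ ≠ ∞) (hpq : p₁.toReal ≤ q.toReal) (hq' : q ≠ ∞)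
    (hu : AEMeasurable (fun t => (u t : ℝ≥0∞)) (volume.restrict (Ioi 0)))
    (hv₁ : AEMeasurable fun x => (v₁ x : ℝ≥0∞))
    (hle : ∀ t, 0 < t → dualNorm p₁ v₁ t * (∫⁻ y in Ioo 0 t, u y * w y) ^ (1 / s) ≤ B)
    (hG : ∀ g : EuclideanSpace ℝ (Fin n) → ℝ≥0∞, AEMeasurable g →
      wNorm p₂ (fun x => (v₂ x : ℝ≥0∞)) univ g ≠ ∞ → ∀ t, 0 < t →
      ∫⁻ y in Ioo 0 t, u y * w y ≠ ∞ →
        (∫⁻ s in Ioo 0 t, u s * (∫⁻ x in coBall n s, g x) ^ q.toReal) ^ (1 / q.toReal) ≤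
      K * (∫⁻ y in Ioo 0 t, u y * w y) ^ (1 / s) *
        wNorm p₂ (fun x => (v₂ x : ℝ≥0∞)) univ g) :
    HardyIneq p₁ p₂ q u v₁ v₂ (8 * (K * B)) := by
  have hD1 := dualNorm_ne_zero hn hp₁ hp₁' hv₁
  refine hardyIneq_of_lintegral_le hK hn hp₁ hp₁' hpq hq' hu hv₁ (fun t ht hUt => ?_)
    fun g hg hY t ht => ?_
  · have hI : (∫⁻ y in Ioo 0 t, u y * w y) ^ (1 / s) ≠ 0 := fun h =>
      lintegral_mul_ne_zero hu hw hw0 hUt ((ENNReal.rpow_eq_zero_iff_of_pos (by positivity)).1 h)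
    have h := hle t ht
    refine ⟨fun h1 => ?_, fun h1 => ?_⟩
    · rw [h1, ENNReal.top_mul hI] at h
      exact ENNReal.coe_ne_top (top_le_iff.1 h)
    · rw [h1, ENNReal.coe_zero, nonpos_iff_eq_zero] at h
      exact mul_ne_zero (hD1 t) hI h
  · have hIt : ∫⁻ y in Ioo 0 t, u y * w y ≠ ∞ := fun h => by
      have h1 := hle t ht
      rw [h, ENNReal.top_rpow_of_pos (by positivity), ENNReal.mul_top (hD1 t)] at h1
      exact ENNReal.coe_ne_top (top_le_iff.1 h1)
    calc _ ≤ dualNorm p₁ v₁ t * (K * (∫⁻ y in Ioo 0 t, u y * w y) ^ (1 / s) *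
          wNorm p₂ (fun x => (v₂ x : ℝ≥0∞)) univ g) := mul_le_mul' le_rfl (hG g hg hY t ht hIt)
      _ = K * (dualNorm p₁ v₁ t * (∫⁻ y in Ioo 0 t, u y * w y) ^ (1 / s)) *
          wNorm p₂ (fun x => (v₂ x : ℝ≥0∞)) univ g := by ring
      _ ≤ _ := by
        gcongr
        exact hle t ht

/-- Sufficiency for `q < p₂ < ∞`. The finiteness of the integral in `B₂` makes `D₂` finite almost
everywhere with respect to `u dt`. -/
theorem hardyIneq_of_B₂_eq (hn : 1 ≤ n) (hp₁ : 1 ≤ p₁) (hp₁' : p₁ ≠ ∞) (hp₂ : 1 ≤ p₂)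
    (hp₁q : p₁.toReal ≤ q.toReal) (hq1 : 1 ≤ q.toReal) (hp₂' : p₂ ≠ ∞) (hq' : q ≠ ∞)
    {r : ℝ} (hr : 0 < r) (hpqr : 1 / r = 1 / q.toReal - 1 / p₂.toReal)
    (hu : AEMeasurable (fun t => (u t : ℝ≥0∞)) (volume.restrict (Ioi 0)))
    (hv₁ : AEMeasurable fun x => (v₁ x : ℝ≥0∞)) (hv₂ : AEMeasurable fun x => (v₂ x : ℝ≥0∞))
    {B : ℝ≥0} (hB : B₂ p₁ p₂ r u v₁ v₂ = B) : HardyIneq p₁ p₂ q u v₁ v₂ (8 * (16 * B)) := by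
  set P := p₂.toReal with hP
  set Q := q.toReal
  have hP1 : 1 ≤ P := by
    rw [hP, ← ENNReal.toReal_one]
    exact ENNReal.toReal_mono hp₂' hp₂
  have hP0 : 0 < P := by linarith
  have hQ0 : 0 < Q := by linarith
  have hD2 := dualNorm_ne_zero hn hp₂ hp₂' hv₂
  have hwm : Measurable fun y => primitive u y ^ (r / P) * dualNorm p₂ v₂ y ^ r :=
    ((monotone_primitive u).measurable.pow_const _).mul
      ((antitone_dualNorm hp₂).measurable.pow_const _)
  have e : ∀ t, ∫⁻ y in Ioo 0 t, primitive u y ^ (r / P) * u y * dualNorm p₂ v₂ y ^ r =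
      ∫⁻ y in Ioo 0 t, u y * (primitive u y ^ (r / P) * dualNorm p₂ v₂ y ^ r) := fun t =>
    lintegral_congr fun y => by ring
  have hUpos : ∀ s, primitive u s ≠ 0 → primitive u s ^ (r / P) ≠ 0 := fun s hs h =>
    hs ((ENNReal.rpow_eq_zero_iff_of_pos (by positivity)).1 h)
  refine hardyIneq_of_dualNorm_mul_le hr hwm (fun s hs => ?_) (by norm_num) hn hp₁ hp₁' hp₁q
    hq' hu hv₁ (fun t ht => ?_) fun g hg hY t ht hIt => ?_
  · exact mul_ne_zero (hUpos s hs) fun h => hD2 s ((ENNReal.rpow_eq_zero_iff_of_pos hr).1 h)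
  · rw [← e, ← hB]
    exact le_iSup₂ (f := fun (t : ℝ) (_ : t ∈ Ioi (0 : ℝ)) => dualNorm p₁ v₁ t *
      (∫⁻ y in Ioo 0 t, primitive u y ^ (r / P) * u y * dualNorm p₂ v₂ y ^ r) ^ (1 / r)) t ht
  have huIoo : AEMeasurable (fun s => (u s : ℝ≥0∞)) (volume.restrict (Ioo 0 t)) :=
    hu.mono_set Ioo_subset_Ioi_self
  set μ := densityOn (Ioo 0 t) fun s => (u s : ℝ≥0∞) with hμ
  set κ : Measure (EuclideanSpace ℝ (Fin n)) := volume.withDensity fun x => g x ^ P * v₂ x with hκ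
  have hκu : κ univ ^ (1 / P) = wNorm p₂ (fun x => (v₂ x : ℝ≥0∞)) univ g := by
    rw [wNorm_of_ne_top hp₂', hκ, withDensity_apply _ MeasurableSet.univ]
  have hκfin : κ univ ≠ ∞ := fun h => hY (by
    rw [← hκu, h, ENNReal.top_rpow_of_pos (by positivity)])
  have hIμ : ∫⁻ y in Ioo 0 t, u y * (primitive u y ^ (r / P) * dualNorm p₂ v₂ y ^ r) =
      ∫⁻ y, primitive u y ^ (r / P) * dualNorm p₂ v₂ y ^ r ∂μ := by
    rw [lintegral_densityOn huIoo hwm]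
  have hIμ' : ∫⁻ y, μ (Iic y) ^ (r / P) * dualNorm p₂ v₂ y ^ r ∂μ =
      ∫⁻ y, primitive u y ^ (r / P) * dualNorm p₂ v₂ y ^ r ∂μ := by
    refine lintegral_congr_ae ?_
    filter_upwards [ae_densityOn_mem measurableSet_Ioo _] with s hs
    rw [hμ, densityOn_Iic _ (Iic_inter_Ioo_zero hs.2)]
    rfl
  rw [hIμ] at hIt ⊢
  have hae : ∀ᵐ s ∂μ, dualNorm p₂ v₂ s ≠ ∞ := by
    filter_upwards [ae_lt_top hwm hIt, ae_densityOn_Ioo_primitive_ne_zero u t] with s hs hs' h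
    rw [h, ENNReal.top_rpow_of_pos hr, ENNReal.mul_top (hUpos s hs'.2)] at hs
    exact hs.ne rfl
  have hmain := (holderBound_dualNorm hp₂ hp₂' hv₂ hg).lintegral_rpow_tail_le_of_lt hQ0 hP0 hr hpqr
    measurable_norm hκfin hae
  simp_rw [tail_withDensity] at hmain
  have hGm : Measurable fun s => (∫⁻ x in coBall n s, g x) ^ Q :=
    (measurable_setLIntegral_coBall g).pow_const _
  rw [hIμ'] at hmain
  set I := ∫⁻ y, primitive u y ^ (r / P) * dualNorm p₂ v₂ y ^ r ∂μ
  rw [lintegral_densityOn huIoo hGm] at hmain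
  have h2 : (2 : ℝ≥0∞) ^ (1 / Q) ≤ 2 := by
    calc (2 : ℝ≥0∞) ^ (1 / Q) ≤ 2 ^ (1 : ℝ) :=
        ENNReal.rpow_le_rpow_of_exponent_le (by norm_num) ((div_le_one hQ0).2 hq1)
      _ = 2 := ENNReal.rpow_one 2
  calc (∫⁻ s in Ioo 0 t, u s * (∫⁻ x in coBall n s, g x) ^ Q) ^ (1 / Q)
      ≤ (2 * 4 ^ Q * ((2 * κ univ) ^ (Q / P) * I ^ (Q / r))) ^ (1 / Q) := by
        gcongr
    _ = 2 ^ (1 / Q) * 4 * (((2 * κ univ) ^ (Q / P)) ^ (1 / Q) * I ^ (1 / r)) := by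
        have h0 : 0 ≤ 1 / Q := by positivity
        rw [ENNReal.mul_rpow_of_nonneg _ _ h0, ENNReal.mul_rpow_of_nonneg _ _ h0,
          ENNReal.mul_rpow_of_nonneg _ _ h0, ← ENNReal.rpow_mul, mul_one_div_cancel hQ0.ne',
          ENNReal.rpow_one, ← ENNReal.rpow_mul I, show Q / r * (1 / Q) = 1 / r by field_simp]
    _ ≤ 2 * 4 * (2 * κ univ ^ (1 / P) * I ^ (1 / r)) := by
        gcongr
        exact rpow_two_mul_rpow_le hP1 hQ0 _
    _ = _ := by
        rw [hκu]
        push_cast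
        ring

/-- Sufficiency for `p₂ = ∞`, where `G ≤ D₂ ‖g‖` pointwise. -/
theorem hardyIneq_of_B₃_eq (hn : 1 ≤ n) (hp₁ : 1 ≤ p₁) (hp₁' : p₁ ≠ ∞)
    (hp₁q : p₁.toReal ≤ q.toReal) (hq : 0 < q.toReal) (hq' : q ≠ ∞)
    (hu : AEMeasurable (fun t => (u t : ℝ≥0∞)) (volume.restrict (Ioi 0)))
    (hv₁ : AEMeasurable fun x => (v₁ x : ℝ≥0∞)) (hv₂ : AEMeasurable fun x => (v₂ x : ℝ≥0∞))
    {B : ℝ≥0} (hB : B₃ p₁ q u v₁ v₂ = B) : HardyIneq p₁ ∞ q u v₁ v₂ (8 * (1 * B)) := by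
  set Q := q.toReal
  have hw : AEMeasurable (fun x => (v₂ x : ℝ≥0∞)⁻¹) := hv₂.inv
  have hD2 := dualNormTop_ne_zero hn hv₂
  have hanti : Antitone (dualNormTop v₂) := fun s t hst => by
    simp only [dualNormTop_eq]
    exact lintegral_mono_set (antitone_coBall n hst)
  have hwm : Measurable fun y => dualNormTop v₂ y ^ Q := hanti.measurable.pow_const _
  refine hardyIneq_of_dualNorm_mul_le hq hwm (fun s hs => ?_) one_ne_zero hn hp₁ hp₁' hp₁q
    hq' hu hv₁ (fun t ht => ?_) fun g hg hY t ht hIt => ?_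
  · exact fun h => hD2 s ((ENNReal.rpow_eq_zero_iff_of_pos hq).1 h)
  · rw [← hB]
    exact le_iSup₂ (f := fun (t : ℝ) (_ : t ∈ Ioi (0 : ℝ)) => dualNorm p₁ v₁ t *
      (∫⁻ y in Ioo 0 t, u y * dualNormTop v₂ y ^ Q) ^ (1 / Q)) t ht
  have huIoo : AEMeasurable (fun s => (u s : ℝ≥0∞)) (volume.restrict (Ioo 0 t)) :=
    hu.mono_set Ioo_subset_Ioi_self
  set Y := wNorm ∞ (fun x => (v₂ x : ℝ≥0∞)) univ g with hYdef
  have hYae : ∀ᵐ x, g x * v₂ x ≤ Y := by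
    rw [hYdef, wNorm_top, Measure.restrict_univ]
    exact ENNReal.ae_le_essSup _
  have hpt : ∀ s, dualNormTop v₂ s ≠ ∞ → ∫⁻ x in coBall n s, g x ≤ Y * dualNormTop v₂ s := by
    intro s hs
    rw [dualNormTop_eq] at hs ⊢
    rw [← lintegral_const_mul' _ _ hY]
    refine lintegral_mono_ae ?_
    filter_upwards [ae_restrict_of_ae hYae, ae_lt_top' hw.restrict hs] with x hx hx'
    have h0 : (v₂ x : ℝ≥0∞) ≠ 0 := fun h => by simp [h] at hx'
    rw [← div_eq_mul_inv]
    exact (ENNReal.le_div_iff_mul_le (Or.inl h0) (Or.inl ENNReal.coe_ne_top)).2 hx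
  have hYQ : Y ^ Q ≠ ∞ := ENNReal.rpow_ne_top_of_nonneg hq.le hY
  have hI : ∫⁻ s in Ioo 0 t, u s * (∫⁻ x in coBall n s, g x) ^ Q ≤
      ∫⁻ s in Ioo 0 t, Y ^ Q * (u s * dualNormTop v₂ s ^ Q) := by
    refine lintegral_mono_ae ?_
    filter_upwards [ae_lt_top' (huIoo.mul hwm.aemeasurable) hIt] with s hs
    rcases eq_or_ne (u s) 0 with h0 | h0
    · simp [h0]
    · have hD : dualNormTop v₂ s ≠ ∞ := fun h => by
        rw [Pi.mul_apply, h, ENNReal.top_rpow_of_pos hq, ENNReal.mul_top (by simpa using h0)] at hs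
        exact hs.ne rfl
      calc (u s : ℝ≥0∞) * (∫⁻ x in coBall n s, g x) ^ Q ≤ u s * (Y * dualNormTop v₂ s) ^ Q := by
            gcongr
            exact hpt s hD
        _ = _ := by rw [ENNReal.mul_rpow_of_nonneg _ _ hq.le]; ring
  refine (ENNReal.rpow_le_rpow hI (show 0 ≤ 1 / Q by positivity)).trans_eq ?_
  rw [lintegral_const_mul' _ _ hYQ, ENNReal.mul_rpow_of_nonneg _ _ (by positivity),
    ← ENNReal.rpow_mul, mul_one_div_cancel hq.ne', ENNReal.rpow_one, ENNReal.coe_one, one_mul,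
    mul_comm]

/-- Two-sided estimates for the admissible constants give the characterization of the inequality
and the equivalence of `B` with the best constant. -/
theorem bestConst_equiv {B : ℝ≥0∞} {K K' : ℝ≥0} (hK' : K' ≠ 0) (hK : K ≠ 0)
    (hlow : ∀ C : ℝ≥0, HardyIneq p₁ p₂ q u v₁ v₂ C → B ≤ K * C)
    (hup : ∀ B' : ℝ≥0, B = B' → HardyIneq p₁ p₂ q u v₁ v₂ (K' * B')) :
    ((∃ C : ℝ≥0, HardyIneq p₁ p₂ q u v₁ v₂ C) ↔ B < ∞) ∧
      ((K⁻¹ : ℝ≥0) : ℝ≥0∞) * B ≤ bestConst p₁ p₂ q u v₁ v₂ ∧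
      bestConst p₁ p₂ q u v₁ v₂ ≤ K' * B := by
  refine ⟨⟨fun ⟨C, hC⟩ => (hlow C hC).trans_lt (ENNReal.mul_lt_top ENNReal.coe_lt_top
    ENNReal.coe_lt_top), fun hB => ⟨K' * B.toNNReal, hup _ (ENNReal.coe_toNNReal hB.ne).symm⟩⟩,
    le_iInf₂ fun C hC => ?_, ?_⟩
  · calc ((K⁻¹ : ℝ≥0) : ℝ≥0∞) * B ≤ ((K⁻¹ : ℝ≥0) : ℝ≥0∞) * (K * C) := by
          gcongr
          exact hlow C hC
      _ = C := by
          rw [← mul_assoc, ← ENNReal.coe_mul, inv_mul_cancel₀ hK, ENNReal.coe_one, one_mul]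
  · rcases eq_or_ne B ∞ with hB | hB
    · rw [hB, ENNReal.mul_top (by simpa using hK')]
      exact le_top
    · refine (iInf₂_le (K' * B.toNNReal) (hup _ (ENNReal.coe_toNNReal hB).symm)).trans_eq ?_
      rw [ENNReal.coe_mul, ENNReal.coe_toNNReal hB]

theorem IsWeightOn.aemeasurable {X : Type*} [TopologicalSpace X] [MeasureSpace X]
    [OpensMeasurableSpace X] [SecondCountableTopology X] {w : X → ℝ≥0} {Ω : Set X}
    (hw : IsWeightOn w Ω) : AEMeasurable (fun x => (w x : ℝ≥0∞)) (volume.restrict Ω) := by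
  have h : AEMeasurable (fun x => (w x : ℝ)) (volume.restrict Ω) :=
    hw.aestronglyMeasurable.aemeasurable
  simpa using h.ennreal_ofReal

end

end BilinearHardy


theorem mainTheorem3 (p₁ p₂ q : ℝ≥0∞) (hp₁ : 1 ≤ p₁) (hp₂ : 1 ≤ p₂) (hp₁q : p₁ ≤ q)
    (hq : q < ∞) :
    ∃ c₁ c₂ : ℝ≥0, 0 < c₁ ∧ 0 < c₂ ∧
      ∀ (n : ℕ), 1 ≤ n → ∀ (u : ℝ → ℝ≥0) (v₁ v₂ : EuclideanSpace ℝ (Fin n) → ℝ≥0),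
        BilinearHardy.IsWeightOn u (Ioi (0 : ℝ)) → BilinearHardy.IsWeightOn v₁ univ →
        BilinearHardy.IsWeightOn v₂ univ →
        (p₂ ≤ q →
          ((∃ C : ℝ≥0, BilinearHardy.HardyIneq p₁ p₂ q u v₁ v₂ C) ↔
            BilinearHardy.B₁ p₁ p₂ q u v₁ v₂ < ∞) ∧
          c₁ * BilinearHardy.B₁ p₁ p₂ q u v₁ v₂ ≤ BilinearHardy.bestConst p₁ p₂ q u v₁ v₂ ∧
          BilinearHardy.bestConst p₁ p₂ q u v₁ v₂ ≤ c₂ * BilinearHardy.B₁ p₁ p₂ q u v₁ v₂) ∧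
        (q < p₂ → p₂ < ∞ → ∀ r₂ : ℝ, 1 / r₂ = 1 / q.toReal - 1 / p₂.toReal →
          ((∃ C : ℝ≥0, BilinearHardy.HardyIneq p₁ p₂ q u v₁ v₂ C) ↔
            BilinearHardy.B₂ p₁ p₂ r₂ u v₁ v₂ < ∞) ∧
          c₁ * BilinearHardy.B₂ p₁ p₂ r₂ u v₁ v₂ ≤ BilinearHardy.bestConst p₁ p₂ q u v₁ v₂ ∧
          BilinearHardy.bestConst p₁ p₂ q u v₁ v₂ ≤ c₂ * BilinearHardy.B₂ p₁ p₂ r₂ u v₁ v₂) ∧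
        (p₂ = ∞ →
          ((∃ C : ℝ≥0, BilinearHardy.HardyIneq p₁ p₂ q u v₁ v₂ C) ↔
            BilinearHardy.B₃ p₁ q u v₁ v₂ < ∞) ∧
          c₁ * BilinearHardy.B₃ p₁ q u v₁ v₂ ≤ BilinearHardy.bestConst p₁ p₂ q u v₁ v₂ ∧
          BilinearHardy.bestConst p₁ p₂ q u v₁ v₂ ≤ c₂ * BilinearHardy.B₃ p₁ q u v₁ v₂) := by
  open BilinearHardy in
  have hq' : q ≠ ∞ := hq.ne
  have hp₁' : p₁ ≠ ∞ := (hp₁q.trans_lt hq).ne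
  have hpq : p₁.toReal ≤ q.toReal := ENNReal.toReal_mono hq' hp₁q
  have hq1 : 1 ≤ q.toReal := by
    rw [← ENNReal.toReal_one]
    exact ENNReal.toReal_mono hq' (hp₁.trans hp₁q)
  have hq0 : 0 < q.toReal := by linarith
  rcases le_or_gt p₂ q with hp₂q | hqp₂
  · have hp₂' : p₂ ≠ ∞ := (hp₂q.trans_lt hq).ne
    refine ⟨1⁻¹, 64, by norm_num, by norm_num, fun n hn u v₁ v₂ hu hv₁ hv₂ =>
      ⟨fun _ => ?_, fun h => absurd hp₂q h.not_ge, fun h => absurd h hp₂'⟩⟩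
    have hu' := hu.aemeasurable
    have hv₁' := hv₁.aemeasurable
    have hv₂' := hv₂.aemeasurable
    rw [Measure.restrict_univ] at hv₁' hv₂'
    refine bestConst_equiv (by norm_num) one_ne_zero (fun C hC => ?_) fun B' hB' => ?_
    · rw [ENNReal.coe_one, one_mul]
      exact iSup₂_le fun t _ =>
        hC.primitive_mul_dualNorm_le hp₁ hp₁' hp₂ hp₂' hq0 hq' hv₁' hv₂' t
    · have := hardyIneq_of_B₁_eq hn hp₁ hp₁' hp₂ hpq (ENNReal.toReal_mono hq' hp₂q) hp₂' hq'
        hu' hv₁' hv₂' hB'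
      rwa [← mul_assoc, show (8 : ℝ≥0) * 8 = 64 by norm_num] at this
  rcases eq_or_ne p₂ ∞ with rfl | hp₂'
  · refine ⟨1⁻¹, 8, by norm_num, by norm_num, fun n hn u v₁ v₂ hu hv₁ hv₂ =>
      ⟨fun h => absurd hqp₂ h.not_gt, fun _ h => absurd rfl h.ne, fun _ => ?_⟩⟩
    have hu' := hu.aemeasurable
    have hv₁' := hv₁.aemeasurable
    have hv₂' := hv₂.aemeasurable
    rw [Measure.restrict_univ] at hv₁' hv₂'
    refine bestConst_equiv (by norm_num) one_ne_zero (fun C hC => ?_) fun B' hB' => ?_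
    · rw [ENNReal.coe_one, one_mul]
      exact iSup₂_le fun t _ =>
        hC.dualNorm_mul_lintegral_dualNormTop_le hp₁ hp₁' hq0 hq' hu' hv₁' hv₂' t
    · have := hardyIneq_of_B₃_eq hn hp₁ hp₁' hpq hq0 hq' hu' hv₁' hv₂' hB'
      rwa [one_mul] at this
  · have hp₂1 : 1 < p₂ := (hp₁.trans hp₁q).trans_lt hqp₂
    -- the exponent `r₂` is determined by `q` and `p₂`
    set r := (1 / q.toReal - 1 / p₂.toReal)⁻¹ with hr
    have hr0 : 0 < r := by
      have h : q.toReal < p₂.toReal := (ENNReal.toReal_lt_toReal hq' hp₂').2 hqp₂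
      exact inv_pos.2 (sub_pos.2 (one_div_lt_one_div_of_lt hq0 h))
    set K : ℝ≥0 := 2 ^ (r / p₂.conjExponent.toReal / q.toReal) * 2 ^ (r / q.toReal / p₂.toReal)
      with hK
    have hK0 : 0 < K := by positivity
    refine ⟨K⁻¹, 128, by positivity, by norm_num, fun n hn u v₁ v₂ hu hv₁ hv₂ =>
      ⟨fun h => absurd hqp₂ h.not_gt, fun _ _ r₂ hr₂ => ?_, fun h => absurd h hp₂'⟩⟩
    obtain rfl : r₂ = r := by rw [hr, ← hr₂, one_div, inv_inv]
    have hu' := hu.aemeasurable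
    have hv₁' := hv₁.aemeasurable
    have hv₂' := hv₂.aemeasurable
    rw [Measure.restrict_univ] at hv₁' hv₂'
    refine bestConst_equiv (by norm_num) hK0.ne' (fun C hC => ?_) fun B' hB' => ?_
    · have e : (K : ℝ≥0∞) = 2 ^ (r / p₂.conjExponent.toReal / q.toReal) *
          2 ^ (r / q.toReal / p₂.toReal) := by
        rw [hK, ENNReal.coe_mul, ENNReal.coe_rpow_of_ne_zero two_ne_zero,
          ENNReal.coe_rpow_of_ne_zero two_ne_zero, ENNReal.coe_ofNat]
      rw [e]
      exact iSup₂_le fun t _ => hC.dualNorm_mul_lintegral_dualNorm_le hn hp₁ hp₁' hp₂1 hp₂' hq1 hq'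
        hr0 hr₂ hu' hv₁' hv₂' t
    · have := hardyIneq_of_B₂_eq hn hp₁ hp₁' hp₂ hpq hq1 hp₂' hq' hr0 hr₂ hu' hv₁' hv₂' hB'
      rwa [← mul_assoc, show (8 : ℝ≥0) * 16 = 128 by norm_num] at this
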